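/- **Setting.** Let $1\le k<d$. For $x\in\mathbb R^d$ write $x^\parallel=(x_1,\dots,x_k)$ and $x^\perp=(x_{k+1},\dots,x_d)$. Let $\mathcal H=L^2(\mathbb R^d)$, with inner product antilinear in the first argument, and let $H=H_0+V$, where $H_0=-\Delta$ with domain $H^2(\mathbb R^d)$ and $V$ is multiplication by a bounded measurable function $V:\mathbb R^d\to\mathbb R$ with $\operatorname{supp}V\subset\{x:\|x^\perp\|\le r_0\}$ for some $r_0>0$. Let $$\Omega^\pm=\operatorname*{s-lim}_{t\to\mp\infty}e^{itH}e^{-itH_0}.$$ Let $\eta=\eta^\parallel\otimes\eta^\perp$ with $\eta^\parallel\in\mathcal S(\mathbb R^k)$, $\eta^\perp\in\mathcal S(\mathbb R^{d-k})$, $\|\eta\|=1$ and $\operatorname{supp}\hat\eta\subset\{\|\xi\|\le1\}$, where $\hat f(\xi)=(2\pi)^{-d/2}\int f(x)e^{-ix\cdot\xi}\,dx$. For $\delta>0$ and $x,p\in\mathbb R^d$ put $\eta_\delta(y)=\delta^{d/2}\eta(\delta y)$ and $\eta_{x,p;\delta}(y)=e^{ip\cdot(y-x)}\eta_\delta(y-x)$.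 For Borel $E\subset\mathbb R^{d}\times\mathbb R^d$ let $$P_\delta(E)\psi=(2\pi)^{-d}\iint_E\langle\eta_{x,p;\delta},\psi\rangle\,\eta_{x,p;\delta}\,dx\,dp$$ as a weakly convergent integral. For $n\ge 0$ and $m>0$ let $W_{n,m;\mathrm{far}}=\{(x,p):\|x^\perp\|>n,\ \|p^\perp\|>m\}$ and let $W_{n,m;\mathrm{sur}}$ be its complement. **Theorem (Enss decomposition).** For every $m>0$ there is $\delta_0=\delta_0(m)>0$, depending on $m$ only, such that the following holds for all $d,k,V,\eta$ as above. The wave operators $\Omega^\pm$ exist on all of $\mathcal H$. For every sequence $(\varphi_n)_{n\ge0}$ of unit vectors in $\mathcal H$ and every $\delta\in(0,\delta_0)$ there are vectors $\varphi_{n;\mathrm{out}},\varphi_{n;\mathrm{in}},\varphi_{n;\mathrm{sur}}\in\mathcal H$ with $\varphi_n=\varphi_{n;\mathrm{out}}+\varphi_{n;\mathrm{in}}+\varphi_{n;\mathrm{sur}}$ for all $n$, such that (a) $\lim_{n\to\infty}\|(\Omega^--1)\varphi_{n;\mathrm{out}}\|=\lim_{n\to\infty}\|(\Omega^+-1)\varphi_{n;\mathrm{in}}\|=0$;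 (b) $\varphi_{n;\mathrm{sur}}=P_\delta(W_{n,m;\mathrm{sur}})\varphi_n$ and $P_\delta(W_{n,m;\mathrm{far}})\varphi_n=\varphi_{n;\mathrm{out}}+\varphi_{n;\mathrm{in}}$ for all $n$; (c) if in addition $\varphi_n=e^{-it_nH}\varphi$ for some $\varphi\in\mathcal H$ and some times $t_n\ge0$, then $\lim_{n\to\infty}\|\varphi_{n;\mathrm{in}}\|=0$. -/

import Mathlib

open MeasureTheory Filter Topology Complex
open scoped FourierTransform SchwartzMap ENNReal InnerProductSpace

namespace EnssSurface

section Abstract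

variable {X : Type*} [NormedAddCommGroup X] [InnerProductSpace ℂ X]

/-- A strongly continuous one-parameter group of isometries (hence of unitaries). -/
structure IsUnitaryGroup (U : ℝ → X →L[ℂ] X) : Prop where
  zero : ∀ ψ, U 0 ψ = ψ
  add : ∀ s t ψ, U (s + t) ψ = U s (U t ψ)
  norm_map : ∀ t ψ, ‖U t ψ‖ = ‖ψ‖
  strong_cont : ∀ ψ, Continuous fun t => U t ψ

/-- `U t = e^{-itH}`: `U` is a strongly continuous unitary group, and its infinitesimal generator is
`-iH`, domain included: `ψ ∈ D(H)` and `Hψ = χ` if and only if `(U t ψ - ψ) / t → -iχ` as `t → 0`. -/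
structure IsPropagator (H : X →ₗ.[ℂ] X) (U : ℝ → X →L[ℂ] X) : Prop extends IsUnitaryGroup U where
  generator : ∀ ψ χ : X,
    (∃ h : ψ ∈ H.domain, H ⟨ψ, h⟩ = χ) ↔
      Tendsto (fun t : ℝ => (t : ℂ)⁻¹ • (U t ψ - ψ)) (𝓝[≠] 0) (𝓝 (-(I • χ)))

lemma IsUnitaryGroup.continuous_uncurry {U : ℝ → X →L[ℂ] X} (hU : IsUnitaryGroup U) :
    Continuous fun p : ℝ × X => U p.1 p.2 := by
  rw [continuous_iff_continuousAt]
  rintro ⟨t, x⟩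
  have h1 : Tendsto (fun p : ℝ × X => U p.1 x) (𝓝 (t, x)) (𝓝 (U t x)) :=
    ((hU.strong_cont x).tendsto t).comp (continuous_fst.tendsto (t, x))
  have h2 : Tendsto (fun p : ℝ × X => U p.1 (p.2 - x)) (𝓝 (t, x)) (𝓝 0) := by
    rw [tendsto_zero_iff_norm_tendsto_zero]
    simp only [hU.norm_map]
    have : Continuous fun p : ℝ × X => ‖p.2 - x‖ := by fun_prop
    simpa using this.tendsto (t, x)
  have := h1.add h2
  simpa [ContinuousAt, map_sub] using this

/-- Terms of the Dyson series of `w' = A(t) w`, `w(0) = ψ`. -/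
noncomputable def dysonTerm (A : ℝ → X →L[ℂ] X) (ψ : X) : ℕ → ℝ → X
  | 0 => fun _ => ψ
  | n + 1 => fun t => ∫ s in (0 : ℝ)..t, A s (dysonTerm A ψ n s)

lemma dysonTerm_continuous {A : ℝ → X →L[ℂ] X} (hA : Continuous fun p : ℝ × X => A p.1 p.2)
    (ψ : X) (n : ℕ) : Continuous (dysonTerm A ψ n) := by
  induction n with
  | zero => exact continuous_const
  | succ n ih =>
    have : Continuous fun s => A s (dysonTerm A ψ n s) := hA.comp (continuous_id.prodMk ih)
    exact intervalIntegral.continuous_primitive (fun a b => this.intervalIntegrable a b) 0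

lemma dysonTerm_hasDerivAt [CompleteSpace X] {A : ℝ → X →L[ℂ] X} (hA : Continuous fun p : ℝ × X => A p.1 p.2)
    (ψ : X) (n : ℕ) (t : ℝ) :
    HasDerivAt (dysonTerm A ψ (n + 1)) (A t (dysonTerm A ψ n t)) t := by
  have : Continuous fun s => A s (dysonTerm A ψ n s) :=
    hA.comp (continuous_id.prodMk (dysonTerm_continuous hA ψ n))
  exact this.integral_hasStrictDerivAt 0 t |>.hasDerivAt

lemma dysonTerm_norm_le {A : ℝ → X →L[ℂ] X} (hA : Continuous fun p : ℝ × X => A p.1 p.2)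
    {M : ℝ} (hM : ∀ t x, ‖A t x‖ ≤ M * ‖x‖) (hM0 : 0 ≤ M) (ψ : X) (n : ℕ) (t : ℝ) :
    ‖dysonTerm A ψ n t‖ ≤ ‖ψ‖ * ((M * |t|) ^ n / n.factorial) := by
  induction n generalizing t with
  | zero => simp [dysonTerm]
  | succ n ih =>
    have hc : Continuous fun s => A s (dysonTerm A ψ n s) :=
      hA.comp (continuous_id.prodMk (dysonTerm_continuous hA ψ n))
    calc ‖dysonTerm A ψ (n + 1) t‖
        ≤ ∫ s in Set.uIoc 0 t, ‖A s (dysonTerm A ψ n s)‖ :=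
          intervalIntegral.norm_integral_le_integral_norm_uIoc
      _ ≤ ∫ s in Set.uIoc 0 t, (M * ‖ψ‖ * M ^ n / n.factorial) * |s - 0| ^ n := by
          apply setIntegral_mono
          · exact (hc.norm).integrableOn_uIoc
          · exact Continuous.integrableOn_uIoc (by fun_prop)
          · intro s
            refine (hM s _).trans ((mul_le_mul_of_nonneg_left (ih s) hM0).trans (le_of_eq ?_))
            simp only [sub_zero]
            ring
      _ = ‖ψ‖ * ((M * |t|) ^ (n + 1) / (n + 1).factorial) := by
          rw [integral_const_mul, integral_pow_abs_sub_uIoc, Nat.factorial_succ]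
          have : (n.factorial : ℝ) ≠ 0 := by positivity
          push_cast
          simp only [sub_zero, mul_pow]
          field_simp
          ring

lemma exists_dyson_solution [CompleteSpace X] {A : ℝ → X →L[ℂ] X} (hA : Continuous fun p : ℝ × X => A p.1 p.2)
    {M : ℝ} (hM : ∀ t x, ‖A t x‖ ≤ M * ‖x‖) (hM0 : 0 ≤ M) (ψ : X) :
    ∃ w : ℝ → X, w 0 = ψ ∧ ∀ t, HasDerivAt w (A t (w t)) t := by
  have hs : ∀ t, Summable fun n => dysonTerm A ψ n t := fun t =>
    Summable.of_norm_bounded ((Real.summable_pow_div_factorial (M * |t|)).mul_left ‖ψ‖)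
      (fun n => dysonTerm_norm_le hA hM hM0 ψ n t)
  refine ⟨fun t => ∑' n, dysonTerm A ψ n t, ?_, fun t => ?_⟩
  · change ∑' n, dysonTerm A ψ n 0 = ψ
    rw [tsum_eq_single 0]
    · rfl
    · intro n hn
      obtain ⟨k, rfl⟩ := Nat.exists_eq_succ_of_ne_zero hn
      simp [dysonTerm]
  · set T : ℝ := |t| + 1
    have hT : 0 < T := by positivity
    have hd : HasDerivAt (fun z => ∑' n, dysonTerm A ψ (n + 1) z)
        (∑' n, A t (dysonTerm A ψ n t)) t := by
      have hu : Summable fun n : ℕ => M * (‖ψ‖ * ((M * T) ^ n / n.factorial)) :=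
        ((Real.summable_pow_div_factorial (M * T)).mul_left ‖ψ‖).mul_left M
      have hb : ∀ (n : ℕ) (y : ℝ), y ∈ Set.Ioo (-T) T →
          ‖A y (dysonTerm A ψ n y)‖ ≤ M * (‖ψ‖ * ((M * T) ^ n / n.factorial)) := by
        intro n y hy
        have hy' : |y| ≤ T := (abs_lt.2 hy).le
        refine (hM y (dysonTerm A ψ n y)).trans (mul_le_mul_of_nonneg_left
          ((dysonTerm_norm_le hA hM hM0 ψ n y).trans ?_) hM0)
        gcongr
      have h0 : (0 : ℝ) ∈ Set.Ioo (-T) T := ⟨by linarith, hT⟩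
      have ht : t ∈ Set.Ioo (-T) T := abs_lt.1 (by simp [T])
      exact hasDerivAt_tsum_of_isPreconnected (g := fun n => dysonTerm A ψ (n + 1))
        (g' := fun n y => A y (dysonTerm A ψ n y)) hu isOpen_Ioo isPreconnected_Ioo
        (fun n y _ => dysonTerm_hasDerivAt hA ψ n y) hb h0 ((summable_nat_add_iff 1).2 (hs 0)) ht
    have e : (fun z => ∑' n, dysonTerm A ψ n z) =
        fun z => ψ + ∑' n, dysonTerm A ψ (n + 1) z := by
      funext z
      rw [(hs z).tsum_eq_zero_add]
      rfl
    rw [← (A t).map_tsum (hs t)] at hd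
    have h := hd.const_add ψ
    rw [← e] at h
    exact h

/-- If `H₀` generates a unitary group and `V` is bounded and symmetric, so does `H₀ + V`. -/
theorem exists_isPropagator_vadd [CompleteSpace X] {H₀ : X →ₗ.[ℂ] X} {G : ℝ → X →L[ℂ] X} (hG : IsPropagator H₀ G)
    (V : X →L[ℂ] X) (hV : ∀ x y, ⟪V x, y⟫_ℂ = ⟪x, V y⟫_ℂ) :
    ∃ U : ℝ → X →L[ℂ] X, IsPropagator ((V : X →ₗ[ℂ] X) +ᵥ H₀) U := by
  have hGc := hG.continuous_uncurry
  have hGinv : ∀ t x, G t (G (-t) x) = x := fun t x => by rw [← hG.add, add_neg_cancel, hG.zero]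
  have hGinv' : ∀ t x, G (-t) (G t x) = x := fun t x => by rw [← hG.add, neg_add_cancel, hG.zero]
  have hGinner : ∀ t x y, ⟪G t x, G t y⟫_ℂ = ⟪x, y⟫_ℂ := fun t x y =>
    (LinearMap.norm_map_iff_inner_map_map (𝕜 := ℂ) (G t)).1 (hG.norm_map t) x y
  -- the interaction picture
  let A : ℝ → X →L[ℂ] X := fun t => -(I • ((G (-t)).comp (V.comp (G t))))
  have hAdef : ∀ t x, A t x = -(I • G (-t) (V (G t x))) := fun t x => rfl
  have hA : Continuous fun p : ℝ × X => A p.1 p.2 := by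
    simp only [hAdef]
    have h1 : Continuous fun p : ℝ × X => V (G p.1 p.2) := V.continuous.comp hGc
    have h2 : Continuous fun p : ℝ × X => G (-p.1) (V (G p.1 p.2)) :=
      hGc.comp (continuous_fst.neg.prodMk h1)
    exact (h2.const_smul I).neg
  have hM : ∀ t x, ‖A t x‖ ≤ ‖V‖ * ‖x‖ := fun t x => by
    rw [hAdef, norm_neg, norm_smul, norm_I, one_mul, hG.norm_map]
    exact (V.le_opNorm _).trans_eq (by rw [hG.norm_map])
  have hskew : ∀ t x, RCLike.re ⟪x, A t x⟫_ℂ = 0 := fun t x => by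
    have h1 : ⟪x, G (-t) (V (G t x))⟫_ℂ = ⟪G t x, V (G t x)⟫_ℂ := by
      rw [← hGinner t, hGinv]
    have h2 : (⟪G t x, V (G t x)⟫_ℂ).im = 0 := by
      have := hV (G t x) (G t x)
      rw [← inner_conj_symm] at this
      exact Complex.conj_eq_iff_im.1 this
    rw [hAdef, inner_neg_right, inner_smul_right, h1]
    simp [h2]
  have hnorm : ∀ w : ℝ → X, (∀ t, HasDerivAt w (A t (w t)) t) → ∀ t, ‖w t‖ = ‖w 0‖ := by
    intro w hw t
    have hd : ∀ t, HasDerivAt (fun t => (⟪w t, w t⟫_ℂ).re) 0 t := by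
      intro t
      have h := (HasDerivAt.inner ℂ (hw t) (hw t))
      have h' := (Complex.reCLM.hasFDerivAt.comp_hasDerivAt t h)
      have e : Complex.reCLM (⟪w t, A t (w t)⟫_ℂ + ⟪A t (w t), w t⟫_ℂ) = 0 := by
        have h0 := hskew t (w t)
        have h1 : (⟪A t (w t), w t⟫_ℂ).re = 0 := by
          rw [← inner_conj_symm, Complex.conj_re]; exact h0
        simp only [Complex.reCLM_apply, Complex.add_re, h1, add_zero]; exact h0
      rw [e] at h'
      exact h'
    have hc := is_const_of_deriv_eq_zero (fun t => (hd t).differentiableAt)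
      (fun t => (hd t).deriv) t 0
    have e : ∀ x : X, (⟪x, x⟫_ℂ).re = ‖x‖ ^ 2 := fun x => (norm_sq_eq_re_inner (𝕜 := ℂ) x).symm
    rw [e, e] at hc
    exact (pow_left_inj₀ (norm_nonneg _) (norm_nonneg _) two_ne_zero).1 hc
  have huniq : ∀ w v : ℝ → X, (∀ t, HasDerivAt w (A t (w t)) t) →
      (∀ t, HasDerivAt v (A t (v t)) t) → w 0 = v 0 → w = v := by
    intro w v hw hv h0
    funext t
    have := hnorm (w - v) (fun t => by simpa using (hw t).sub (hv t)) t
    simp only [Pi.sub_apply, h0, sub_self, norm_zero, norm_eq_zero] at this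
    exact sub_eq_zero.1 this
  choose w hw0 hw using fun ψ => exists_dyson_solution hA hM (norm_nonneg V) ψ
  have hadd : ∀ x y t, w (x + y) t = w x t + w y t := fun x y t => congrFun
    (huniq (w (x + y)) (fun t => w x t + w y t) (hw _)
      (fun t => by rw [map_add]; exact (hw x t).add (hw y t)) (by simp [hw0])) t
  have hsmul : ∀ (c : ℂ) x t, w (c • x) t = c • w x t := fun c x t => congrFun
    (huniq (w (c • x)) (fun t => c • w x t) (hw _)
      (fun t => by rw [map_smul]; exact (hw x t).const_smul c) (by simp [hw0])) t
  let W : ℝ → X →L[ℂ] X := fun t =>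
    LinearMap.mkContinuous
      { toFun := fun ψ => w ψ t, map_add' := fun x y => hadd x y t,
        map_smul' := fun c x => hsmul c x t } 1
      (fun ψ => by simp [hnorm _ (hw ψ) t, hw0])
  have hW : ∀ t ψ, W t ψ = w ψ t := fun t ψ => rfl
  have hGW : ∀ s t ψ, w ψ (t + s) = G (-s) (w (G s (w ψ s)) t) := by
    intro s t ψ
    have h1 : ∀ t, HasDerivAt (fun t => G s (w ψ (t + s))) (A t (G s (w ψ (t + s)))) t := by
      intro t
      have h := (hw ψ (t + s)).comp_add_const t s
      have h' := ((G s).restrictScalars ℝ).hasFDerivAt.comp_hasDerivAt t h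
      have e : (G s) (A (t + s) (w ψ (t + s))) = A t (G s (w ψ (t + s))) := by
        simp only [hAdef, map_neg, map_smul]
        rw [← hG.add, ← hG.add]
        congr 4
        ring
      rw [← e]
      exact h'
    have h2 : G s (w ψ (t + s)) = w (G s (w ψ s)) t :=
      congrFun (huniq _ _ h1 (hw (G s (w ψ s))) (by simp [hw0])) t
    rw [← h2, hGinv']
  refine ⟨fun t => (G t).comp (W t), ⟨⟨?_, ?_, ?_, ?_⟩, ?_⟩⟩
  · intro ψ; simp [hW, hG.zero, hw0]
  · intro s t ψ
    simp only [ContinuousLinearMap.comp_apply, hW]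
    rw [hGW, ← hG.add, add_neg_cancel_right]
  · intro t ψ
    simp only [ContinuousLinearMap.comp_apply, hW]
    rw [hG.norm_map, hnorm _ (hw ψ), hw0]
  · intro ψ
    have h : Continuous (w ψ) := continuous_iff_continuousAt.2 fun t => (hw ψ t).continuousAt
    exact hGc.comp (continuous_id.prodMk h)
  · intro ψ χ
    have key : Tendsto (fun t : ℝ => (t : ℂ)⁻¹ • (G t (w ψ t) - G t ψ)) (𝓝[≠] 0)
        (𝓝 (-(I • V ψ))) := by
      have h := hasDerivAt_iff_tendsto_slope_zero.1 (hw ψ 0)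
      have e : A 0 (w ψ 0) = -(I • V ψ) := by
        rw [hAdef, hw0, neg_zero, hG.zero, hG.zero]
      rw [e] at h
      have hp : Tendsto (fun t : ℝ => ((t, t⁻¹ • (w ψ (0 + t) - w ψ 0)) : ℝ × X)) (𝓝[≠] 0)
          (𝓝 (0, -(I • V ψ))) := (tendsto_nhdsWithin_of_tendsto_nhds tendsto_id).prodMk_nhds h
      have := (hGc.tendsto _).comp hp
      simp only [hG.zero] at this
      refine this.congr fun t => ?_
      simp only [Function.comp, zero_add, hw0]
      rw [← map_sub, ← map_smul, ← Complex.ofReal_inv, Complex.coe_smul]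
    have hgen := hG.generator ψ (χ - V ψ)
    have e1 : (∃ h : ψ ∈ ((V : X →ₗ[ℂ] X) +ᵥ H₀).domain, ((V : X →ₗ[ℂ] X) +ᵥ H₀) ⟨ψ, h⟩ = χ) ↔
        ∃ h : ψ ∈ H₀.domain, H₀ ⟨ψ, h⟩ = χ - V ψ := by
      constructor
      · rintro ⟨h, rfl⟩
        exact ⟨h, by simp [LinearPMap.vadd_apply]⟩
      · rintro ⟨h, h'⟩
        exact ⟨h, by simp [LinearPMap.vadd_apply, h']⟩
    rw [e1, hgen]
    simp only [ContinuousLinearMap.comp_apply, hW]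
    constructor
    · intro h
      convert! h.add key using 2
      · rw [← smul_add]; congr 1; abel
      · rw [smul_sub]; abel
    · intro h
      convert! h.sub key using 2
      · rw [← smul_sub]; congr 1; abel
      · rw [smul_sub]; abel

end Abstract

section L2

variable (n : ℕ)

/-- `ℝⁿ` with its Euclidean norm. -/
abbrev Rn (n : ℕ) := EuclideanSpace ℝ (Fin n)

/-- The Hilbert space `L²(ℝⁿ)`; its inner product is antilinear in the first argument. -/
noncomputable abbrev L2 (n : ℕ) := Lp ℂ 2 (volume : Measure (Rn n))

/-- Multiplication by a bounded measurable function, as a bounded operator on `L²(ℝⁿ)`. -/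
noncomputable def mulOp {n : ℕ} (g : Rn n → ℂ) (hg : MemLp g ∞ (volume : Measure (Rn n))) :
    L2 n →L[ℂ] L2 n :=
  (ContinuousLinearMap.mul ℂ ℂ).holderL volume ∞ 2 2 (hg.toLp g)

lemma mulOp_coeFn {n : ℕ} (g : Rn n → ℂ) (hg : MemLp g ∞ (volume : Measure (Rn n))) (f : L2 n) :
    mulOp g hg f =ᵐ[volume] fun x => g x * f x := by
  have h1 := (ContinuousLinearMap.mul ℂ ℂ).coeFn_holder (r := 2) (hg.toLp g) f
  filter_upwards [h1, hg.coeFn_toLp] with x hx hx'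
  rw [mulOp, ContinuousLinearMap.holderL_apply_apply, hx, hx']
  rfl

lemma mulOp_symm {n : ℕ} (g : Rn n → ℝ) (hg : MemLp (fun x => (g x : ℂ)) ∞ (volume : Measure (Rn n)))
    (f h : L2 n) : ⟪mulOp _ hg f, h⟫_ℂ = ⟪f, mulOp _ hg h⟫_ℂ := by
  rw [L2.inner_def, L2.inner_def]
  refine integral_congr_ae ?_
  filter_upwards [mulOp_coeFn _ hg f, mulOp_coeFn _ hg h] with x hx hx'
  rw [hx, hx']
  simp
  ring

/-- The symbol of `-Δ`: with the kernel `e^{-2πi⟨x,ξ⟩}` of Mathlib's Fourier transform, `-Δ` is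
multiplication by `|2πξ|²`. -/
noncomputable def freeSymbol {n : ℕ} (ξ : Rn n) : ℝ := (2 * Real.pi * ‖ξ‖) ^ 2

@[fun_prop]
lemma freeSymbol_continuous {n : ℕ} : Continuous (freeSymbol (n := n)) := by
  unfold freeSymbol; fun_prop

/-- The functions `f ∈ L²(ℝⁿ)` with `|2πξ|² f ∈ L²(ℝⁿ)`. -/
def symbolDomain : Submodule ℂ (L2 n) where
  carrier := {f | MemLp (fun ξ => (freeSymbol ξ : ℂ) * f ξ) 2 volume}
  add_mem' := by
    intro a b ha hb
    refine (MemLp.add ha hb).ae_eq ?_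
    filter_upwards [Lp.coeFn_add a b] with x hx
    simp only [Pi.add_apply, hx]
    ring
  zero_mem' := by
    refine (MemLp.zero' (p := 2)).ae_eq ?_
    filter_upwards [Lp.coeFn_zero ℂ 2 (volume : Measure (Rn n))] with x hx
    rw [hx]
    simp
  smul_mem' := by
    intro c a ha
    refine (MemLp.const_smul ha c).ae_eq ?_
    filter_upwards [Lp.coeFn_smul c a] with x hx
    simp only [Pi.smul_apply, hx, smul_eq_mul]
    ring

lemma symbolDomain_toLp_add (a b : L2 n)
    (ha : MemLp (fun ξ => (freeSymbol ξ : ℂ) * a ξ) 2 volume)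
    (hb : MemLp (fun ξ => (freeSymbol ξ : ℂ) * b ξ) 2 volume)
    (hc : MemLp (fun ξ => (freeSymbol ξ : ℂ) * (a + b) ξ) 2 volume) :
    (MemLp.toLp (fun ξ => (freeSymbol ξ : ℂ) * (a + b) ξ) hc : L2 n) =
      MemLp.toLp (fun ξ => (freeSymbol ξ : ℂ) * a ξ) ha +
        MemLp.toLp (fun ξ => (freeSymbol ξ : ℂ) * b ξ) hb := by
  rw [← MemLp.toLp_add]
  refine MemLp.toLp_congr _ _ ?_
  filter_upwards [Lp.coeFn_add a b] with x hx
  simp only [Pi.add_apply, hx]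
  ring

lemma symbolDomain_toLp_smul (c : ℂ) (a : L2 n)
    (ha : MemLp (fun ξ => (freeSymbol ξ : ℂ) * a ξ) 2 volume)
    (hc : MemLp (fun ξ => (freeSymbol ξ : ℂ) * (c • a) ξ) 2 volume) :
    (MemLp.toLp (fun ξ => (freeSymbol ξ : ℂ) * (c • a) ξ) hc : L2 n) =
      c • MemLp.toLp (fun ξ => (freeSymbol ξ : ℂ) * a ξ) ha := by
  rw [← MemLp.toLp_const_smul]
  refine MemLp.toLp_congr _ _ ?_
  filter_upwards [Lp.coeFn_smul c a] with x hx
  simp only [Pi.smul_apply, hx, smul_eq_mul]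
  ring

/-- The maximal operator of multiplication by `|2πξ|²` on `L²(ℝⁿ)`. -/
noncomputable def symbolOp : L2 n →ₗ.[ℂ] L2 n where
  domain := symbolDomain n
  toFun :=
    { toFun := fun f => MemLp.toLp (fun ξ => (freeSymbol ξ : ℂ) * (f : L2 n) ξ) f.2
      map_add' := fun a b => symbolDomain_toLp_add n a b a.2 b.2 (a + b).2
      map_smul' := fun c a => symbolDomain_toLp_smul n c a a.2 (c • a).2 }

/-- The Fourier transform as a unitary operator on `L²(ℝⁿ)`. -/
noncomputable abbrev fourierL2 : L2 n ≃ₗᵢ[ℂ] L2 n := Lp.fourierTransformₗᵢ (Rn n) ℂ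

/-- `H₀ = -Δ = 𝓕⁻¹ |2πξ|² 𝓕` on `L²(ℝⁿ)`, with domain `H²(ℝⁿ) = {ψ | |2πξ|² 𝓕ψ ∈ L²}`. -/
noncomputable def freeHamiltonian : L2 n →ₗ.[ℂ] L2 n where
  domain := (symbolOp n).domain.comap (fourierL2 n).toLinearEquiv.toLinearMap
  toFun := (fourierL2 n).symm.toLinearEquiv.toLinearMap ∘ₗ (symbolOp n).toFun ∘ₗ
    (fourierL2 n).toLinearEquiv.toLinearMap.restrict (fun _ h => h)

lemma memLp_phase (t : ℝ) :
    MemLp (fun ξ : Rn n => cexp (I * ((-t * freeSymbol ξ : ℝ) : ℂ))) ∞ volume := by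
  refine memLp_top_of_bound (Continuous.aestronglyMeasurable (by fun_prop)) 1 (.of_forall fun ξ => ?_)
  rw [mul_comm, Complex.norm_exp_ofReal_mul_I]

/-- Multiplication by `e^{-it|2πξ|²}`. -/
noncomputable def phaseOp (t : ℝ) : L2 n →L[ℂ] L2 n := mulOp _ (memLp_phase n t)

/-- `e^{-itH₀} = 𝓕⁻¹ e^{-it|2πξ|²} 𝓕`. -/
noncomputable def freePropagator (t : ℝ) : L2 n →L[ℂ] L2 n :=
  ((fourierL2 n).symm : L2 n →L[ℂ] L2 n) ∘L phaseOp n t ∘L (fourierL2 n : L2 n →L[ℂ] L2 n)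

lemma phaseOp_coeFn (t : ℝ) (f : L2 n) :
    phaseOp n t f =ᵐ[volume] fun ξ => cexp (I * ((-t * freeSymbol ξ : ℝ) : ℂ)) * f ξ :=
  mulOp_coeFn _ _ f

variable {n}

lemma tendsto_L2_of_dominated {ι : Type*} {l : Filter ι} [l.IsCountablyGenerated]
    (F : ι → L2 n) (f : L2 n) (F' : ι → Rn n → ℂ) (f' : Rn n → ℂ)
    (hF : ∀ i, F i =ᵐ[volume] F' i) (hf : f =ᵐ[volume] f')
    (bound : L2 n) (h1 : ∀ i, ∀ᵐ x, ‖F' i x - f' x‖ ≤ 2 * ‖bound x‖)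
    (h2 : ∀ᵐ x, Tendsto (fun i => F' i x) l (𝓝 (f' x))) : Tendsto F l (𝓝 f) := by
  rw [Lp.tendsto_Lp_iff_tendsto_eLpNorm']
  have e : ∀ i, eLpNorm (⇑(F i) - ⇑f) 2 volume =
      (∫⁻ x, ‖F' i x - f' x‖ₑ ^ (2 : ℝ)) ^ (1 / 2 : ℝ) := by
    intro i
    rw [eLpNorm_eq_lintegral_rpow_enorm_toReal two_ne_zero ENNReal.ofNat_ne_top]
    simp only [ENNReal.toReal_ofNat]
    congr 1
    refine lintegral_congr_ae ?_
    filter_upwards [hF i, hf] with x hx hx'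
    simp [hx, hx']
  simp only [e]
  have hm : ∀ i, AEMeasurable (F' i) volume := fun i =>
    (Lp.aestronglyMeasurable (F i)).aemeasurable.congr (hF i)
  have hm' : AEMeasurable f' volume := (Lp.aestronglyMeasurable f).aemeasurable.congr hf
  have key : Tendsto (fun i => ∫⁻ x, ‖F' i x - f' x‖ₑ ^ (2 : ℝ)) l (𝓝 (∫⁻ _ : Rn n, 0)) := by
    refine tendsto_of_seq_tendsto fun u hu => ?_
    refine tendsto_lintegral_of_dominated_convergence'
      (fun x => (ENNReal.ofReal (2 * ‖bound x‖)) ^ (2 : ℝ)) ?_ ?_ ?_ ?_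
    · exact fun i => ((hm (u i)).sub hm').enorm.pow_const _
    · intro i
      filter_upwards [h1 (u i)] with x hx
      gcongr
      rw [← ofReal_norm]
      exact ENNReal.ofReal_le_ofReal hx
    · have hb := (Lp.memLp ((2 : ℂ) • bound)).2
      rw [eLpNorm_eq_lintegral_rpow_enorm_toReal two_ne_zero ENNReal.ofNat_ne_top] at hb
      simp only [ENNReal.toReal_ofNat] at hb
      have hb' := (ENNReal.rpow_lt_top_iff_of_pos (by norm_num)).1 hb
      refine (lt_of_le_of_lt (le_of_eq ?_) hb').ne
      refine lintegral_congr_ae ?_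
      filter_upwards [Lp.coeFn_smul (2 : ℂ) bound] with x hx
      rw [hx, ← ofReal_norm]
      simp
    · filter_upwards [h2] with x hx
      have h := (((hx.comp hu).sub_const (f' x)).enorm).ennrpow_const (2 : ℝ)
      simpa using h
  rw [lintegral_zero] at key
  simpa using key.ennrpow_const (1 / 2 : ℝ)

lemma norm_phase_sub_one_le (θ : ℝ) : ‖cexp (I * (θ : ℂ)) - 1‖ ≤ |θ| :=
  Real.norm_exp_I_mul_ofReal_sub_one_le

variable (n)

lemma phaseOp_isUnitaryGroup : IsUnitaryGroup (phaseOp n) where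
  zero f := by
    refine Lp.ext ?_
    filter_upwards [phaseOp_coeFn n 0 f] with x hx
    rw [hx]; simp
  add s t f := by
    refine Lp.ext ?_
    filter_upwards [phaseOp_coeFn n (s + t) f, phaseOp_coeFn n s (phaseOp n t f),
      phaseOp_coeFn n t f] with x h1 h2 h3
    rw [h1, h2, h3, ← mul_assoc, ← Complex.exp_add]
    congr 2
    push_cast; ring
  norm_map t f := by
    rw [Lp.norm_def, Lp.norm_def]
    congr 1
    refine eLpNorm_congr_norm_ae ?_
    filter_upwards [phaseOp_coeFn n t f] with x hx
    rw [hx, norm_mul, mul_comm I, Complex.norm_exp_ofReal_mul_I, one_mul]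
  strong_cont f := by
    rw [continuous_iff_continuousAt]
    intro t
    refine tendsto_L2_of_dominated _ _ _ _ (fun s => phaseOp_coeFn n s f) (phaseOp_coeFn n t f) f
      (fun s => .of_forall fun x => ?_) (.of_forall fun x => ?_)
    · rw [← sub_mul, norm_mul]
      gcongr
      refine (norm_sub_le _ _).trans ?_
      rw [mul_comm I, Complex.norm_exp_ofReal_mul_I, mul_comm I, Complex.norm_exp_ofReal_mul_I]
      norm_num
    · have : Continuous fun s : ℝ => cexp (I * ((-s * freeSymbol x : ℝ) : ℂ)) * f x := by fun_prop
      exact this.tendsto t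

lemma phase_slope_tendsto (a : ℝ) (z : ℂ) :
    Tendsto (fun t : ℝ => (t : ℂ)⁻¹ * (cexp (I * ((-t * a : ℝ) : ℂ)) * z - z)) (𝓝[≠] 0)
      (𝓝 (-(I * (a * z)))) := by
  have h : HasDerivAt (fun t : ℝ => cexp (I * ((-t * a : ℝ) : ℂ)) * z) (-(I * (a * z))) 0 := by
    have h0 : HasDerivAt (fun t : ℝ => I * ((-t * a : ℝ) : ℂ)) (I * ((-1 * a : ℝ) : ℂ)) 0 :=
      (((hasDerivAt_id (0 : ℝ)).neg.mul_const a).ofReal_comp).const_mul I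
    have h1 := (h0.cexp).mul_const z
    convert! h1 using 1
    simp
    ring
  have := hasDerivAt_iff_tendsto_slope_zero.1 h
  refine this.congr fun t => ?_
  simp [Complex.real_smul]

lemma phaseOp_slope_coeFn (f : L2 n) (t : ℝ) :
    ((t : ℂ)⁻¹ • (phaseOp n t f - f) : L2 n) =ᵐ[volume] fun ξ =>
      (t : ℂ)⁻¹ * (cexp (I * ((-t * freeSymbol ξ : ℝ) : ℂ)) * f ξ - f ξ) := by
  filter_upwards [Lp.coeFn_smul ((t : ℂ)⁻¹) (phaseOp n t f - f), Lp.coeFn_sub (phaseOp n t f) f,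
    phaseOp_coeFn n t f] with x h1 h2 h3
  rw [h1, Pi.smul_apply, h2, Pi.sub_apply, h3, smul_eq_mul]

lemma phaseOp_isPropagator : IsPropagator (symbolOp n) (phaseOp n) where
  toIsUnitaryGroup := phaseOp_isUnitaryGroup n
  generator f g := by
    constructor
    · rintro ⟨hf, rfl⟩
      have hg : symbolOp n ⟨f, hf⟩ =ᵐ[volume] fun ξ => (freeSymbol ξ : ℂ) * f ξ :=
        MemLp.coeFn_toLp (f := fun ξ => (freeSymbol ξ : ℂ) * f ξ) hf
      generalize symbolOp n ⟨f, hf⟩ = g at hg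
      have hg' : (-(I • g) : L2 n) =ᵐ[volume] fun ξ => -(I * ((freeSymbol ξ : ℂ) * f ξ)) := by
        filter_upwards [Lp.coeFn_neg (I • g), Lp.coeFn_smul I g, hg] with x h1 h2 h3
        rw [h1, Pi.neg_apply, h2, Pi.smul_apply, h3, smul_eq_mul]
      refine tendsto_L2_of_dominated _ _ _ _ (fun t => phaseOp_slope_coeFn n f t) hg' g
        (fun t => ?_) (.of_forall fun x => phase_slope_tendsto _ _)
      filter_upwards [hg] with x hx
      rw [hx]
      set a := freeSymbol x
      set z := f x
      have h1 : ‖(t : ℂ)⁻¹ * (cexp (I * ((-t * a : ℝ) : ℂ)) * z - z)‖ ≤ ‖(a : ℂ) * z‖ := by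
        have e : cexp (I * ((-t * a : ℝ) : ℂ)) * z - z = (cexp (I * ((-t * a : ℝ) : ℂ)) - 1) * z := by
          ring
        rw [e, ← mul_assoc, norm_mul, norm_mul, norm_mul (a : ℂ)]
        gcongr
        rw [norm_inv, Complex.norm_real, Complex.norm_real]
        rcases eq_or_ne t 0 with rfl | ht
        · simp
        · have := norm_phase_sub_one_le (-t * a)
          rw [abs_mul, abs_neg] at this
          rw [Real.norm_eq_abs, Real.norm_eq_abs, inv_mul_le_iff₀ (abs_pos.2 ht)]
          exact this
      refine (norm_sub_le _ _).trans ?_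
      rw [norm_neg, norm_mul I, norm_I, one_mul]
      linarith
    · intro h
      have hu : Tendsto (fun k : ℕ => (1 : ℝ) / ((k : ℝ) + 1)) atTop (𝓝[≠] 0) :=
        tendsto_nhdsWithin_iff.2 ⟨tendsto_one_div_add_atTop_nhds_zero_nat,
          .of_forall fun k => by simp; positivity⟩
      have h' := h.comp hu
      obtain ⟨ns, hns, hae⟩ := (tendstoInMeasure_of_tendsto_Lp h').exists_seq_tendsto_ae
      have hsl : ∀ᵐ x, ∀ k : ℕ, _ := ae_all_iff.2 fun k : ℕ =>
        phaseOp_slope_coeFn n f ((1 : ℝ) / ((ns k : ℝ) + 1))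
      have hg : g =ᵐ[volume] fun ξ => (freeSymbol ξ : ℂ) * f ξ := by
        filter_upwards [hae, hsl, Lp.coeFn_neg (I • g), Lp.coeFn_smul I g] with x h1 h2 h3 h4
        have h5 := ((phase_slope_tendsto (freeSymbol x) (f x)).comp hu).comp hns.tendsto_atTop
        have h6 := tendsto_nhds_unique (h1.congr fun k => h2 k) h5
        rw [h3, Pi.neg_apply, h4, Pi.smul_apply, smul_eq_mul, neg_inj] at h6
        exact mul_left_cancel₀ I_ne_zero h6
      have hm : f ∈ (symbolOp n).domain := (Lp.memLp g).ae_eq hg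
      refine ⟨hm, Lp.ext ?_⟩
      exact (MemLp.coeFn_toLp (f := fun ξ => (freeSymbol ξ : ℂ) * f ξ) hm).trans hg.symm

theorem freePropagator_isPropagator : IsPropagator (freeHamiltonian n) (freePropagator n) := by
  have hP := phaseOp_isPropagator n
  have hdef : ∀ t ψ, freePropagator n t ψ = (fourierL2 n).symm (phaseOp n t (fourierL2 n ψ)) :=
    fun _ _ => rfl
  refine ⟨⟨fun ψ => ?_, fun s t ψ => ?_, fun t ψ => ?_, fun ψ => ?_⟩, fun ψ χ => ?_⟩
  · rw [hdef, hP.zero, LinearIsometryEquiv.symm_apply_apply]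
  · simp only [hdef, LinearIsometryEquiv.apply_symm_apply, hP.add]
  · rw [hdef, LinearIsometryEquiv.norm_map, hP.norm_map, LinearIsometryEquiv.norm_map]
  · simp only [hdef]
    exact (fourierL2 n).symm.continuous.comp (hP.strong_cont _)
  · have e1 : (∃ h : ψ ∈ (freeHamiltonian n).domain, freeHamiltonian n ⟨ψ, h⟩ = χ) ↔
        ∃ h : fourierL2 n ψ ∈ (symbolOp n).domain,
          symbolOp n ⟨fourierL2 n ψ, h⟩ = fourierL2 n χ := by
      constructor
      · rintro ⟨h, rfl⟩
        exact ⟨h, ((fourierL2 n).apply_symm_apply _).symm⟩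
      · rintro ⟨h, h'⟩
        exact ⟨h, (congrArg (fourierL2 n).symm h').trans ((fourierL2 n).symm_apply_apply χ)⟩
    rw [e1, hP.generator]
    simp only [hdef]
    constructor
    · intro h
      have := ((fourierL2 n).symm.continuous.tendsto _).comp h
      simpa [Function.comp_def] using this
    · intro h
      have := ((fourierL2 n).continuous.tendsto _).comp h
      simpa [Function.comp_def] using this

end L2

section Model

variable {k l : ℕ}

/-- The longitudinal component `x^∥ = (x₁, …, x_k)` of `x ∈ ℝ^{k+l}`. -/
def longitudinal (x : Rn (k + l)) : Rn k := WithLp.toLp 2 fun i => x (Fin.castAdd l i)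

/-- The transverse component `x^⊥ = (x_{k+1}, …, x_{k+l})` of `x ∈ ℝ^{k+l}`. -/
def transverse (x : Rn (k + l)) : Rn l := WithLp.toLp 2 fun j => x (Fin.natAdd k j)

/-- A bounded measurable real potential on `ℝ^d`, `d = k + l`, supported in some slab
`{x | ‖x^⊥‖ ≤ r₀}`. -/
structure SurfacePotential (k l : ℕ) where
  toFun : Rn (k + l) → ℝ
  measurable : Measurable toFun
  bounded : ∃ M : ℝ, ∀ x, |toFun x| ≤ M
  supported : ∃ r₀ : ℝ, 0 < r₀ ∧ ∀ x, toFun x ≠ 0 → ‖transverse x‖ ≤ r₀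

namespace SurfacePotential

variable (V : SurfacePotential k l)

lemma memLp_top : MemLp (fun x => (V.toFun x : ℂ)) ∞ volume := by
  obtain ⟨M, hM⟩ := V.bounded
  refine memLp_top_of_bound (Complex.measurable_ofReal.comp V.measurable).aestronglyMeasurable M
    (.of_forall fun x => ?_)
  rw [Complex.norm_real]
  exact hM x

/-- Multiplication by `V` on `L²(ℝ^d)`. -/
noncomputable def op : L2 (k + l) →L[ℂ] L2 (k + l) := mulOp _ V.memLp_top

/-- `H = H₀ + V`, with the domain of `H₀ = -Δ`. -/
noncomputable def hamiltonian : L2 (k + l) →ₗ.[ℂ] L2 (k + l) :=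
  (V.op : L2 (k + l) →ₗ[ℂ] L2 (k + l)) +ᵥ freeHamiltonian (k + l)

theorem exists_propagator : ∃ U : ℝ → L2 (k + l) →L[ℂ] L2 (k + l), IsPropagator V.hamiltonian U :=
  exists_isPropagator_vadd (freePropagator_isPropagator (k + l)) V.op
    (mulOp_symm V.toFun V.memLp_top)

/-- `V.propagator t = e^{-itH}`, the unitary group generated by `H`. -/
noncomputable def propagator : ℝ → L2 (k + l) →L[ℂ] L2 (k + l) := V.exists_propagator.choose

theorem isPropagator_propagator : IsPropagator V.hamiltonian V.propagator :=
  V.exists_propagator.choose_spec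

/-- `Ω` is the strong limit of `e^{itH} e^{-itH₀}` along the filter `F`, on all of `L²(ℝ^d)`.
The wave operator `Ω⁻` is the case `F = atTop` and `Ω⁺` is the case `F = atBot`. -/
def IsWaveOperator (F : Filter ℝ) (Ω : L2 (k + l) →L[ℂ] L2 (k + l)) : Prop :=
  ∀ ψ, Tendsto (fun t : ℝ => V.propagator (-t) (freePropagator (k + l) t ψ)) F (𝓝 (Ω ψ))

end SurfacePotential

/-- The Fourier transform `(2π)^{-n/2} ∫ f(x) e^{-i⟨x,ξ⟩} dx`. -/
noncomputable def angularFourier {n : ℕ} (f : Rn n → ℂ) (ξ : Rn n) : ℂ :=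
  (((2 * Real.pi) ^ (-(n : ℝ) / 2) : ℝ) : ℂ) *
    ∫ x, f x * cexp (-(I * ((inner ℝ x ξ : ℝ) : ℂ)))

/-- A window `η = η^∥ ⊗ η^⊥` with Schwartz factors, `‖η‖ = 1` in `L²(ℝ^d)` and `supp η̂ ⊂ B₁`. -/
structure Window (k l : ℕ) where
  par : 𝓢(Rn k, ℂ)
  perp : 𝓢(Rn l, ℂ)
  norm_one : ∫ x : Rn (k + l), ‖par (longitudinal x) * perp (transverse x)‖ ^ 2 = 1
  fourier_support : ∀ ξ : Rn (k + l), 1 < ‖ξ‖ →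
    angularFourier (fun x => par (longitudinal x) * perp (transverse x)) ξ = 0

namespace Window

variable (η : Window k l)

/-- The function `η(x) = η^∥(x^∥) η^⊥(x^⊥)`. -/
noncomputable def toFun (x : Rn (k + l)) : ℂ := η.par (longitudinal x) * η.perp (transverse x)

/-- `η_δ(y) = δ^{d/2} η(δy)`, i.e. `η̂_δ(p) = δ^{-d/2} η̂(p/δ)`. -/
noncomputable def scaled (δ : ℝ) (y : Rn (k + l)) : ℂ :=
  ((δ ^ (((k + l : ℕ) : ℝ) / 2) : ℝ) : ℂ) * η.toFun (δ • y)

/-- The coherent state `η_{x,p;δ}(y) = e^{i⟨p, y-x⟩} η_δ(y-x)`, for `z = (x, p)`. -/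
noncomputable def coherent (δ : ℝ) (z : Rn (k + l) × Rn (k + l)) (y : Rn (k + l)) : ℂ :=
  cexp (I * ((inner ℝ z.2 (y - z.1) : ℝ) : ℂ)) * η.scaled δ (y - z.1)

/-- The inner product `⟨η_{x,p;δ}, ψ⟩` in `L²(ℝ^d)`, for `z = (x, p)`. -/
noncomputable def overlap (δ : ℝ) (ψ : L2 (k + l)) (z : Rn (k + l) × Rn (k + l)) : ℂ :=
  ∫ y, (starRingEnd ℂ) (η.coherent δ z y) * ψ y

/-- `v = P_δ(E)ψ`, that is, `v` is the weakly convergent integral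
`(2π)^{-d} ∬_E ⟨η_{x,p;δ}, ψ⟩ η_{x,p;δ} dx dp`: for every `φ`, the function
`⟨φ, η_{x,p;δ}⟩ ⟨η_{x,p;δ}, ψ⟩` is integrable on `E` and `(2π)^{-d}` times its integral is
`⟨φ, v⟩`. -/
def IsLocalization (δ : ℝ) (E : Set (Rn (k + l) × Rn (k + l))) (ψ v : L2 (k + l)) : Prop :=
  ∀ φ : L2 (k + l),
    IntegrableOn (fun z => (starRingEnd ℂ) (η.overlap δ φ z) * η.overlap δ ψ z) E
        (volume : Measure (Rn (k + l) × Rn (k + l))) ∧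
      ⟪φ, v⟫_ℂ = ((((2 * Real.pi) ^ (k + l))⁻¹ : ℝ) : ℂ) *
        ∫ z in E, (starRingEnd ℂ) (η.overlap δ φ z) * η.overlap δ ψ z

end Window

/-- The far set `{(x, p) | ‖x^⊥‖ > r, ‖p^⊥‖ > m}` in phase space. -/
def farSet (k l : ℕ) (r m : ℝ) : Set (Rn (k + l) × Rn (k + l)) :=
  {z | r < ‖transverse z.1‖ ∧ m < ‖transverse z.2‖}

/-- The surface set, the complement of the far set. -/
def surfaceSet (k l : ℕ) (r m : ℝ) : Set (Rn (k + l) × Rn (k + l)) := (farSet k l r m)ᶜ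

end Model

end EnssSurface

open EnssSurface

/-!
The decomposition is `φ_out = P(W_out) φ`, `φ_in = P(W_in) φ`, `φ_sur = P(W_sur) φ`, where the far
set is split according to the sign of `⟨x^⊥, p^⊥⟩`, that is, according to whether the free classical
motion `x + 2tp` leaves the surface or approaches it. One may take `δ₀ = m / 8`.

**Escape estimate.** By Galilei covariance (`Profile.packet_apply`) the packet `e^{-itH₀} η_{x,p}` is,
up to a phase and the factor `e^{i⟨p, y⟩}`, the wave `g_t = e^{-itH₀} η_δ` centred at `v = x + 2tp`.
In the coordinates `(v, p)`, Plancherel's formula in `p` alone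
(`Profile.lintegral_inner_packet`) turns the weight in phase space of a back-evolved vector
`e^{itH₀} f` into `∬ |g_t(y - v)|² |f(y)|² dy dv`. No bound on the momenta and no decay along the
surface is needed, and neither is the product structure of the window. Hence, when `f` lives within
`r` of the surface and the flow carries `E` to distance `R` from it, `P(E) e^{itH₀} f` is controlled by
the tail of `g_t` beyond `R - r`. As `η̂_δ` is supported in the ball of radius `δ`, the
tail beyond `4δ|t|` decays rapidly (`Profile.exists_norm_wave_le`, by nonstationary phase in the
direction of `u`), while `R ≥ n / 2 + m |t|` on an outgoing set. The outcome
(`Profile.exists_norm_localization_le`, `norm_op_freePropagator_localization_le`) is a bound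
`‖V e^{-itH₀} P(W)‖ ≤ C (n / 4 + m |t| / 2)⁻²`, for `t ≥ 0` on `W_out` and for `t ≤ 0` on `W_in`.

**Consequences.** Cook's method integrates this to `‖(Ω^∓ - 1) P(W)‖ = O(1 / n)`, which is (a). The wave
operators exist by the same method, applied to packets with transverse momentum away from zero; these
are total because `{ξ | ξ^⊥ = 0}` is a null set. Part (b) is the resolution of the identity
`Profile.localization_univ`. For (c), take adjoints in (a) to replace `P(W_in) φ_n` by
`P(W_in) (Ω⁺)* e^{-it_nH} φ = P(W_in) e^{-it_nH₀} (Ω⁺)* φ`, which tends to zero by the escape estimate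
with `t = -t_n`, after cutting `(Ω⁺)* φ` off at large distance from the surface.
-/

namespace EnssSurface

/-! ### Nonstationary phase -/

section NonstationaryPhase

/-- A smooth substitute for `1 / (1 - x)`, equal to it for `|x| ≤ 1 / 2`. -/
lemma exists_smooth_inverse_one_sub :
    ∃ q : ℝ → ℝ, ContDiff ℝ (⊤ : ℕ∞) q ∧ ∀ x, |x| ≤ 1 / 2 → q x * (1 - x) = 1 := by
  let f : ContDiffBump (0 : ℝ) := ⟨1 / 2, 3 / 4, by norm_num, by norm_num⟩
  have hpos : ∀ x, 0 < 1 - x * f x := by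
    intro x
    rcases lt_or_ge x (3 / 4) with h | h
    · rcases le_total x 0 with h0 | h0
      · nlinarith [f.nonneg (x := x)]
      · nlinarith [f.nonneg (x := x), f.le_one (x := x)]
    · rw [f.zero_of_le_dist (by simpa [Real.dist_eq] using h.trans (le_abs_self x))]
      norm_num
  refine ⟨fun x => (1 - x * f x)⁻¹, ?_, fun x hx => ?_⟩
  · exact ContDiff.inv (contDiff_const.sub (contDiff_id.mul f.contDiff)) fun x => (hpos x).ne'
  · have h1 : f x = 1 := f.one_of_mem_closedBall (by
      rw [Metric.mem_closedBall, dist_zero_right]; exact hx)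
    have := (hpos x).ne'
    rw [h1, mul_one] at this
    simp only [h1, mul_one]
    exact inv_mul_cancel₀ this

variable {E : Type*} [NormedAddCommGroup E] [InnerProductSpace ℝ E]

lemma hasFDerivAt_cexp_phase (r τ : ℝ) (e ξ : E) :
    HasFDerivAt (fun ξ : E => cexp (I * ((r * (inner ℝ e ξ - τ / 2 * ‖ξ‖ ^ 2) : ℝ) : ℂ)))
      (cexp (I * ((r * (inner ℝ e ξ - τ / 2 * ‖ξ‖ ^ 2) : ℝ) : ℂ)) •
        (I • (Complex.ofRealCLM.comp (r • (innerSL ℝ e - (τ / 2) • ((2 : ℝ) • innerSL ℝ ξ)))))) ξ := by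
  have h1 : HasFDerivAt (fun ξ : E => r * (inner ℝ e ξ - τ / 2 * ‖ξ‖ ^ 2))
      (r • (innerSL ℝ e - (τ / 2) • ((2 : ℝ) • innerSL ℝ ξ))) ξ := by
    have h2 : HasFDerivAt (fun ξ : E => ‖ξ‖ ^ 2) ((2 : ℝ) • innerSL ℝ ξ) ξ := by
      convert (hasStrictFDerivAt_norm_sq ξ).hasFDerivAt using 1
      rw [ofNat_smul_eq_nsmul]
    exact (((innerSL ℝ e).hasFDerivAt).sub (h2.const_mul (τ / 2))).const_mul r
  exact ((Complex.ofRealCLM.hasFDerivAt.comp ξ h1).const_mul I).cexp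

variable [FiniteDimensional ℝ E] [MeasurableSpace E] [BorelSpace E]

/-- Nonstationary phase, uniformly in the parameters `τ` and `e`: each integration by parts in the
direction `e`, along which the phase has derivative `r (1 - τ ⟨e, ξ⟩)`, gains a factor `1 / r`. The
amplitude is allowed to depend smoothly on the parameters, so that the new amplitude is of the same
kind; compactness of the parameter set bounds the last one. -/
lemma exists_norm_integral_phase_le {κ : ℝ} (hκ : 0 < κ) (N : ℕ) :
    ∀ F : (ℝ × E) × E → ℂ, ContDiff ℝ (⊤ : ℕ∞) F → (∀ p ξ, κ < ‖ξ‖ → F (p, ξ) = 0) →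
      ∃ C : ℝ, 0 ≤ C ∧ ∀ (r τ : ℝ) (e : E), 0 < r → |τ| * κ ≤ 1 / 2 → ‖e‖ = 1 →
        ‖∫ ξ, cexp (I * ((r * (inner ℝ e ξ - τ / 2 * ‖ξ‖ ^ 2) : ℝ) : ℂ)) * F ((τ, e), ξ)‖
          ≤ C * (r ^ N)⁻¹ := by
  induction N with
  | zero =>
    intro F hF hsupp
    let K : Set ((ℝ × E) × E) :=
      (Metric.closedBall (0 : ℝ) (1 / (2 * κ)) ×ˢ Metric.closedBall (0 : E) 1) ×ˢ
        Metric.closedBall (0 : E) κ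
    have hK : IsCompact K := ((isCompact_closedBall _ _).prod (isCompact_closedBall _ _)).prod
      (isCompact_closedBall _ _)
    obtain ⟨B, hB⟩ := hK.exists_bound_of_continuousOn hF.continuous.continuousOn
    refine ⟨|B| * volume.real (Metric.closedBall (0 : E) κ), by positivity, fun r τ e _ hτ he => ?_⟩
    have hz : ∀ ξ, ξ ∉ Metric.closedBall (0 : E) κ →
        cexp (I * ((r * (inner ℝ e ξ - τ / 2 * ‖ξ‖ ^ 2) : ℝ) : ℂ)) * F ((τ, e), ξ) = 0 := by
      intro ξ hξ
      rw [hsupp _ _ (by simpa using hξ), mul_zero]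
    rw [← setIntegral_eq_integral_of_forall_compl_eq_zero hz, pow_zero, inv_one, mul_one]
    refine norm_setIntegral_le_of_norm_le_const measure_closedBall_lt_top fun ξ hξ => ?_
    rw [norm_mul, mul_comm I, Complex.norm_exp_ofReal_mul_I, one_mul]
    refine (hB _ ⟨⟨?_, ?_⟩, hξ⟩).trans (le_abs_self _)
    · simp only [Metric.mem_closedBall, dist_zero_right, Real.norm_eq_abs]
      rw [le_div_iff₀ (by positivity)]
      linarith
    · simp [he]
  | succ N ih =>
    intro F hF hsupp
    obtain ⟨q, hq, hq1⟩ := exists_smooth_inverse_one_sub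
    -- Dividing the amplitude by the derivative of the phase; `q` makes the quotient smooth everywhere.
    let G : (ℝ × E) × E → ℂ := fun z => (q (z.1.1 * inner ℝ z.1.2 z.2) : ℂ) * F z
    have hG : ContDiff ℝ (⊤ : ℕ∞) G := by
      refine ContDiff.mul (Complex.ofRealCLM.contDiff.comp (hq.comp ?_)) hF
      exact (contDiff_fst.comp contDiff_fst).mul
        ((contDiff_snd.comp contDiff_fst).inner ℝ contDiff_snd)
    let F' : (ℝ × E) × E → ℂ := fun z => fderiv ℝ G z (0, z.1.2)
    have hF' : ContDiff ℝ (⊤ : ℕ∞) F' :=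
      (hG.fderiv_right (m := (⊤ : ℕ∞)) (by simp)).clm_apply
        (contDiff_const.prodMk (contDiff_snd.comp contDiff_fst))
    have hGd : ∀ p ξ, HasFDerivAt (fun ξ : E => G (p, ξ))
        ((fderiv ℝ G (p, ξ)).comp (ContinuousLinearMap.inr ℝ (ℝ × E) E)) ξ := by
      intro p ξ
      exact ((hG.differentiable (by simp)) (p, ξ)).hasFDerivAt.comp ξ (hasFDerivAt_prodMk_right p ξ)
    have hGz : ∀ p ξ, κ < ‖ξ‖ → G (p, ξ) = 0 := fun p ξ h => by simp [G, hsupp p ξ h]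
    have hF'z : ∀ p ξ, κ < ‖ξ‖ → F' (p, ξ) = 0 := by
      intro p ξ h
      have h1 : (fun ξ : E => G (p, ξ)) =ᶠ[𝓝 ξ] fun _ => 0 := by
        filter_upwards [(isOpen_lt continuous_const continuous_norm).mem_nhds h] with ξ' h'
        exact hGz p ξ' h'
      have h2 := (hGd p ξ).unique ((hasFDerivAt_const (0 : ℂ) ξ).congr_of_eventuallyEq h1)
      have h3 := congrArg (fun L => L p.2) h2
      simpa [F'] using h3
    obtain ⟨C, hC, hCb⟩ := ih F' hF' hF'z
    refine ⟨C, hC, fun r τ e hr hτ he => ?_⟩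
    set θ : E → ℂ := fun ξ => cexp (I * ((r * (inner ℝ e ξ - τ / 2 * ‖ξ‖ ^ 2) : ℝ) : ℂ)) with hθ
    have hθc : Continuous θ := by fun_prop
    have hint : ∀ H : (ℝ × E) × E → ℂ, Continuous H → (∀ p ξ, κ < ‖ξ‖ → H (p, ξ) = 0) →
        ∀ w : E → ℂ, Continuous w → Integrable (fun ξ => w ξ * H ((τ, e), ξ)) := by
      intro H hH hHz w hw
      refine Continuous.integrable_of_hasCompactSupport
        (hw.mul (hH.comp (continuous_const.prodMk continuous_id))) ?_
      refine HasCompactSupport.of_support_subset_isCompact (isCompact_closedBall (0 : E) κ) ?_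
      intro ξ hξ
      by_contra h
      exact hξ (by simp [hHz _ ξ (by simpa using h)])
    have hder := fun ξ => hasFDerivAt_cexp_phase r τ e ξ
    have hphase : ∀ ξ, (θ ξ • (I • (Complex.ofRealCLM.comp
        (r • (innerSL ℝ e - (τ / 2) • ((2 : ℝ) • innerSL ℝ ξ)))))) e =
          θ ξ * (I * ((r * (1 - τ * inner ℝ e ξ) : ℝ) : ℂ)) := by
      intro ξ
      simp [he, real_inner_comm]
      ring_nf
      simp
    have hparts := integral_bilinear_hasFDerivAt_right_eq_neg_left_of_integrable (μ := volume)
      (f := fun ξ => G ((τ, e), ξ)) (g := θ) (v := e) (B := ContinuousLinearMap.mul ℝ ℂ)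
      (f' := fun ξ => (fderiv ℝ G ((τ, e), ξ)).comp (ContinuousLinearMap.inr ℝ (ℝ × E) E))
      (g' := fun ξ => θ ξ • (I • (Complex.ofRealCLM.comp
        (r • (innerSL ℝ e - (τ / 2) • ((2 : ℝ) • innerSL ℝ ξ))))))
      ?_ ?_ ?_ (fun ξ _ => hGd _ ξ) (fun ξ _ => hder ξ)
    · have e1 : ∀ ξ, (ContinuousLinearMap.mul ℝ ℂ) (G ((τ, e), ξ)) ((θ ξ • (I •
          (Complex.ofRealCLM.comp (r • (innerSL ℝ e - (τ / 2) • ((2 : ℝ) • innerSL ℝ ξ)))))) e) =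
            (I * r) * (θ ξ * F ((τ, e), ξ)) := by
        intro ξ
        rw [hphase]
        by_cases hξ : κ < ‖ξ‖
        · simp [hGz _ ξ hξ, hsupp _ ξ hξ]
        · have : |τ * inner ℝ e ξ| ≤ 1 / 2 := by
            rw [abs_mul]
            refine le_trans ?_ hτ
            gcongr
            refine (abs_real_inner_le_norm e ξ).trans ?_
            rw [he, one_mul]
            exact not_lt.1 hξ
          have hq2 := congrArg (fun x : ℝ => (x : ℂ)) (hq1 _ this)
          simp only [ContinuousLinearMap.mul_apply', G]
          push_cast at hq2 ⊢
          linear_combination (θ ξ * I * r * F ((τ, e), ξ)) * hq2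
      have e2 : ∀ ξ, (ContinuousLinearMap.mul ℝ ℂ) (((fderiv ℝ G ((τ, e), ξ)).comp
          (ContinuousLinearMap.inr ℝ (ℝ × E) E)) e) (θ ξ) = θ ξ * F' ((τ, e), ξ) := by
        intro ξ
        simp [F', mul_comm]
      simp only [e1, e2] at hparts
      rw [integral_const_mul] at hparts
      have hn := congrArg norm hparts
      rw [norm_mul, norm_neg, norm_mul, norm_I, one_mul, Complex.norm_real, Real.norm_eq_abs,
        abs_of_pos hr] at hn
      have hb := hCb r τ e hr hτ he
      rw [← hn] at hb
      rw [pow_succ, mul_inv, ← mul_assoc]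
      rwa [← div_eq_mul_inv, le_div_iff₀ hr, mul_comm]
    · have := hint F' hF'.continuous hF'z θ hθc
      refine this.congr (.of_forall fun ξ => ?_)
      simp [F', mul_comm]
    · have := hint G hG.continuous hGz
        (fun ξ => θ ξ * (I * ((r * (1 - τ * inner ℝ e ξ) : ℝ) : ℂ))) (by fun_prop)
      refine this.congr (.of_forall fun ξ => ?_)
      simp only
      rw [hphase, ContinuousLinearMap.mul_apply', mul_comm]
    · have := hint G hG.continuous hGz θ hθc
      refine this.congr (.of_forall fun ξ => ?_)
      simp [mul_comm]

end NonstationaryPhase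

/-! ### Free wave packets and Plancherel's formula -/

section Packets

variable {d : ℕ}

/-- A smooth function on frequency space vanishing outside the ball of radius `κ`: the Fourier
transform of a wave packet at rest. -/
structure Profile (d : ℕ) (κ : ℝ) where
  toFun : Rn d → ℂ
  smooth : ContDiff ℝ (⊤ : ℕ∞) toFun
  zero_of_lt : ∀ ξ, κ < ‖ξ‖ → toFun ξ = 0

namespace Profile

variable {κ : ℝ} (s : Profile d κ)

/-- The free evolution `e^{-itH₀} 𝓕⁻¹ s`, as a function. -/
noncomputable def wave (t : ℝ) (u : Rn d) : ℂ :=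
  ∫ ξ, cexp (I * ((2 * Real.pi * inner ℝ ξ u - t * freeSymbol ξ : ℝ) : ℂ)) * s.toFun ξ

/-- The Fourier transform of the free evolution at time `t` of the packet `𝓕⁻¹ s` translated by `x`
in space and by `p` in momentum. In the frequency variable `ξ` the momentum is `2πξ`. -/
noncomputable def symbol (t : ℝ) (x p ξ : Rn d) : ℂ :=
  cexp (-(I * ((2 * Real.pi * inner ℝ ξ x + t * freeSymbol ξ : ℝ) : ℂ))) *
    s.toFun (ξ - (2 * Real.pi)⁻¹ • p)

lemma symbol_contDiff (t : ℝ) (x p : Rn d) : ContDiff ℝ (⊤ : ℕ∞) (s.symbol t x p) := by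
  have h1 : ContDiff ℝ (⊤ : ℕ∞) fun ξ : Rn d => 2 * Real.pi * inner ℝ ξ x + t * freeSymbol ξ := by
    have : ContDiff ℝ (⊤ : ℕ∞) fun ξ : Rn d => ‖ξ‖ ^ 2 := contDiff_norm_sq ℝ
    have h2 : ContDiff ℝ (⊤ : ℕ∞) fun ξ : Rn d => inner ℝ ξ x :=
      contDiff_id.inner ℝ contDiff_const
    simp only [freeSymbol, mul_pow]
    fun_prop
  refine ContDiff.mul (ContDiff.cexp ?_) (s.smooth.comp (contDiff_id.sub contDiff_const))
  exact (contDiff_const.mul (Complex.ofRealCLM.contDiff.comp h1)).neg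

lemma symbol_hasCompactSupport (t : ℝ) (x p : Rn d) : HasCompactSupport (s.symbol t x p) := by
  refine HasCompactSupport.of_support_subset_isCompact
    (isCompact_closedBall ((2 * Real.pi)⁻¹ • p) κ) fun ξ hξ => ?_
  by_contra h
  refine hξ ?_
  rw [symbol, s.zero_of_lt, mul_zero]
  simpa [dist_eq_norm] using h

/-- The free evolution at time `t` of the packet `𝓕⁻¹ s` translated by `(x, p)` in phase space. -/
noncomputable def packet (t : ℝ) (x p : Rn d) : 𝓢(Rn d, ℂ) :=
  𝓕⁻ ((s.symbol_hasCompactSupport t x p).toSchwartzMap (s.symbol_contDiff t x p))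

/-- Galilei covariance of the free evolution. -/
lemma packet_apply (t : ℝ) (x p y : Rn d) :
    s.packet t x p y =
      cexp (I * ((inner ℝ p (y - x) - t * ‖p‖ ^ 2 : ℝ) : ℂ)) * s.wave t (y - (x + (2 * t) • p)) := by
  have hpi : (2 * Real.pi) ≠ 0 := by positivity
  rw [packet, SchwartzMap.fourierInv_coe, Real.fourierInv_eq']
  rw [← integral_add_right_eq_self _ ((2 * Real.pi)⁻¹ • p), wave, ← integral_const_mul]
  refine integral_congr_ae (.of_forall fun ξ => ?_)
  simp only [HasCompactSupport.toSchwartzMap_toFun, symbol, add_sub_cancel_right, smul_eq_mul]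
  rw [← mul_assoc, ← mul_assoc, ← Complex.exp_add, ← Complex.exp_add]
  congr 2
  have e1 : freeSymbol (ξ + (2 * Real.pi)⁻¹ • p) =
      freeSymbol ξ + 4 * Real.pi * inner ℝ ξ p + ‖p‖ ^ 2 := by
    simp only [freeSymbol, mul_pow, norm_add_sq_real, norm_smul, inner_smul_right, norm_inv,
      Real.norm_eq_abs, sq_abs, inv_pow]
    field_simp
    ring
  rw [e1]
  simp only [inner_add_left, inner_sub_right, inner_add_right, inner_smul_left, inner_smul_right,
    RCLike.conj_to_real]
  push_cast
  have hpi' : (Real.pi : ℂ) ≠ 0 := by exact_mod_cast Real.pi_ne_zero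
  field_simp
  ring

lemma packet_zero_zero (t : ℝ) : ⇑(s.packet t 0 0) = s.wave t := by
  funext y
  simp [packet_apply]

lemma freePropagator_packet (r t : ℝ) (x p : Rn d) :
    freePropagator d t ((s.packet r x p).toLp 2) = (s.packet (r + t) x p).toLp 2 := by
  have h1 : ∀ r, fourierL2 d ((s.packet r x p).toLp 2) =
      ((s.symbol_hasCompactSupport r x p).toSchwartzMap (s.symbol_contDiff r x p)).toLp 2 := by
    intro r
    have := SchwartzMap.toLp_fourier_eq (s.packet r x p)
    refine this.trans ?_
    rw [packet, FourierTransform.fourier_fourierInv_eq]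
  apply (fourierL2 d).injective
  rw [h1]
  change fourierL2 d ((fourierL2 d).symm (phaseOp d t (fourierL2 d _))) = _
  rw [LinearIsometryEquiv.apply_symm_apply, h1]
  refine Lp.ext ?_
  filter_upwards [phaseOp_coeFn d t (((s.symbol_hasCompactSupport r x p).toSchwartzMap
      (s.symbol_contDiff r x p)).toLp 2), SchwartzMap.coeFn_toLp
      ((s.symbol_hasCompactSupport r x p).toSchwartzMap (s.symbol_contDiff r x p)) 2,
      SchwartzMap.coeFn_toLp ((s.symbol_hasCompactSupport (r + t) x p).toSchwartzMap
      (s.symbol_contDiff (r + t) x p)) 2] with ξ a b c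
  rw [a, b, c]
  simp only [HasCompactSupport.toSchwartzMap_toFun, symbol]
  rw [← mul_assoc, ← Complex.exp_add]
  congr 2
  push_cast
  ring

lemma wave_continuous (t : ℝ) : Continuous (s.wave t) := by
  rw [← packet_zero_zero]; exact (s.packet t 0 0).continuous

lemma wave_memLp (t : ℝ) (p : ℝ≥0∞) : MemLp (s.wave t) p := by
  rw [← packet_zero_zero]; exact (s.packet t 0 0).memLp p

/-- At twice the radius `4πκ|t|` of the classically allowed region and beyond, the free evolution
decays rapidly, uniformly in time. -/
lemma exists_norm_wave_le (hκ : 0 < κ) (N : ℕ) : ∃ C : ℝ, 0 ≤ C ∧ ∀ (t : ℝ) (u : Rn d),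
    0 < ‖u‖ → 8 * Real.pi * κ * |t| ≤ ‖u‖ → ‖s.wave t u‖ ≤ C * (‖u‖ ^ N)⁻¹ := by
  obtain ⟨C, hC, h⟩ := exists_norm_integral_phase_le (E := Rn d) hκ N (fun z => s.toFun z.2)
    (s.smooth.comp contDiff_snd) (fun p ξ hξ => s.zero_of_lt ξ hξ)
  refine ⟨C, hC, fun t u hu htu => ?_⟩
  have hpi := Real.pi_pos
  -- The phase is `2π‖u‖ (⟨e, ξ⟩ - τ ‖ξ‖² / 2)` with `e = u / ‖u‖` and `τ = 4πt / ‖u‖`.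
  have h1 := h (2 * Real.pi * ‖u‖) (4 * Real.pi * t / ‖u‖) (‖u‖⁻¹ • u) (by positivity) ?_ ?_
  · have e : s.wave t u = ∫ ξ, cexp (I * ((2 * Real.pi * ‖u‖ * (inner ℝ (‖u‖⁻¹ • u) ξ -
        4 * Real.pi * t / ‖u‖ / 2 * ‖ξ‖ ^ 2) : ℝ) : ℂ)) * s.toFun ξ := by
      refine integral_congr_ae (.of_forall fun ξ => ?_)
      simp only [inner_smul_left, RCLike.conj_to_real, freeSymbol, real_inner_comm u ξ]
      congr 5
      field_simp
      ring
    rw [e]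
    refine h1.trans ?_
    gcongr
    nlinarith [Real.pi_gt_three]
  · rw [abs_div, abs_mul, abs_of_pos hu, abs_of_pos (by positivity : 0 < 4 * Real.pi),
      div_mul_eq_mul_div, div_le_iff₀ hu]
    linarith
  · rw [norm_smul, norm_inv, norm_norm, inv_mul_cancel₀ hu.ne']

/-- The part of a free wave beyond a distance `ρ` that the classical motion does not reach. -/
lemma exists_lintegral_wave_le (hκ : 0 < κ) : ∃ C : ℝ, 0 ≤ C ∧ ∀ t ρ : ℝ, 1 ≤ ρ →
    8 * Real.pi * κ * |t| ≤ ρ →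
      ∫⁻ u in {u | ρ ≤ ‖u‖}, ‖s.wave t u‖ₑ ^ 2 ≤ ENNReal.ofReal ((C * (ρ ^ 2)⁻¹) ^ 2) := by
  -- `d + 1` powers make the tail integrable; the other two give the rate.
  obtain ⟨C, hC, h⟩ := s.exists_norm_wave_le hκ (d + 1 + 2)
  set J : ℝ := ∫ u : Rn d, (1 + ‖u‖) ^ (-((d + 1 : ℕ) : ℝ)) with hJ
  have hint : Integrable fun u : Rn d => (1 + ‖u‖) ^ (-((d + 1 : ℕ) : ℝ)) := by
    refine integrable_one_add_norm ?_
    simp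
  have hJ0 : 0 ≤ J := integral_nonneg fun u => by positivity
  refine ⟨C * √(2 ^ (d + 1) * J), by positivity, fun t ρ hρ htρ => ?_⟩
  have hρ0 : 0 < ρ := by linarith
  have hpt : ∀ u ∈ {u : Rn d | ρ ≤ ‖u‖}, ‖s.wave t u‖ₑ ^ 2 ≤
      ENNReal.ofReal ((C * (ρ ^ 2)⁻¹) ^ 2 * 2 ^ (d + 1) * (1 + ‖u‖) ^ (-((d + 1 : ℕ) : ℝ))) := by
    intro u hu
    have hu1 : ρ ≤ ‖u‖ := hu
    have hu0 : 0 < ‖u‖ := hρ0.trans_le hu1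
    rw [← ofReal_norm, ← ENNReal.ofReal_pow (norm_nonneg _)]
    refine ENNReal.ofReal_le_ofReal ?_
    refine (pow_le_pow_left₀ (norm_nonneg _) (h t u hu0 (htρ.trans hu1)) 2).trans ?_
    rw [Real.rpow_neg (by positivity), Real.rpow_natCast, pow_add, mul_inv, mul_comm (_⁻¹) (_⁻¹),
      ← mul_assoc, mul_pow, mul_assoc]
    have h2 : ((‖u‖ ^ (d + 1))⁻¹) ^ 2 ≤ 2 ^ (d + 1) * ((1 + ‖u‖) ^ (d + 1))⁻¹ := by
      have h3 : 1 ≤ ‖u‖ ^ (d + 1) := one_le_pow₀ (hρ.trans hu1)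
      have h4 : (1 + ‖u‖) ^ (d + 1) ≤ 2 ^ (d + 1) * ‖u‖ ^ (d + 1) := by
        rw [← mul_pow]
        exact pow_le_pow_left₀ (by positivity) (by linarith) _
      rw [← div_eq_mul_inv, le_div_iff₀ (by positivity)]
      calc ((‖u‖ ^ (d + 1))⁻¹) ^ 2 * (1 + ‖u‖) ^ (d + 1)
          ≤ ((‖u‖ ^ (d + 1))⁻¹) ^ 2 * (2 ^ (d + 1) * ‖u‖ ^ (d + 1)) := by gcongr
        _ = 2 ^ (d + 1) * (‖u‖ ^ (d + 1))⁻¹ := by field_simp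
        _ ≤ 2 ^ (d + 1) * 1 := by gcongr; exact inv_le_one_of_one_le₀ h3
        _ = 2 ^ (d + 1) := mul_one _
    gcongr
  have hmeas : MeasurableSet {u : Rn d | ρ ≤ ‖u‖} :=
    measurableSet_le measurable_const measurable_norm
  refine (setLIntegral_mono' hmeas hpt).trans ((setLIntegral_le_lintegral _ _).trans ?_)
  rw [← ofReal_integral_eq_lintegral_ofReal (hint.const_mul _)
    (.of_forall fun u => by positivity), integral_const_mul, ← hJ]
  refine ENNReal.ofReal_le_ofReal (le_of_eq ?_)
  rw [mul_right_comm C, mul_pow (C * _), Real.sq_sqrt (by positivity), mul_assoc]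

end Profile

end Packets

section Plancherel

variable {d : ℕ}

lemma lintegral_enorm_sq_eq {α : Type*} [MeasurableSpace α] {μ : Measure α} (f : Lp ℂ 2 μ) :
    ∫⁻ x, ‖f x‖ₑ ^ 2 ∂μ = ENNReal.ofReal (‖f‖ ^ 2) := by
  rw [ENNReal.ofReal_pow (norm_nonneg _), ofReal_norm, Lp.enorm_def,
    eLpNorm_eq_lintegral_rpow_enorm_toReal two_ne_zero ENNReal.ofNat_ne_top,
    ← ENNReal.rpow_natCast, ← ENNReal.rpow_mul]
  simp

/-- On `L¹ ∩ L²` the unitary Fourier transform is given by the Fourier integral. -/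
lemma fourierL2_toLp_ae_eq {h : Rn d → ℂ} (h1 : Integrable h) (h2 : MemLp h 2) :
    fourierL2 d (h2.toLp h) =ᵐ[volume] 𝓕 h := by
  have hL : LocallyIntegrable (fourierL2 d (h2.toLp h)) :=
    (Lp.memLp _).locallyIntegrable (by norm_num)
  have hcont : Continuous (𝓕 h) := VectorFourier.fourierIntegral_continuous
    Real.continuous_fourierChar continuous_inner h1
  refine ae_eq_of_integral_contDiff_smul_eq hL hcont.locallyIntegrable fun g hg hgs => ?_
  have hgs' : HasCompactSupport fun x => (g x : ℂ) := hgs.comp_left (g := fun x : ℝ => (x : ℂ)) rfl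
  have hg' : ContDiff ℝ (⊤ : ℕ∞) fun x => (g x : ℂ) := Complex.ofRealCLM.contDiff.comp hg
  let φ : 𝓢(Rn d, ℂ) := hgs'.toSchwartzMap hg'
  have e1 := congrArg (fun T : 𝓢'(Rn d, ℂ) => T φ)
    (Lp.fourier_toTemperedDistribution_eq (h2.toLp h))
  simp only [TemperedDistribution.fourier_apply, Lp.toTemperedDistribution_apply] at e1
  have e2 : ∫ x, (g x) • (fourierL2 d (h2.toLp h)) x = ∫ x, φ x • (fourierL2 d (h2.toLp h)) x := by
    simp [φ]
  have e3 : ∫ x, (g x) • (𝓕 h) x = ∫ x, φ x • (𝓕 h) x := by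
    simp [φ]
  have e4 : ∫ x, (𝓕 φ) x • (h2.toLp h) x = ∫ x, (𝓕 φ) x • h x := by
    refine integral_congr_ae ?_
    filter_upwards [h2.coeFn_toLp] with x hx
    rw [hx]
  have e5 : ∫ x, (𝓕 φ) x • h x = ∫ x, φ x • (𝓕 h) x := by
    have := VectorFourier.integral_fourierIntegral_smul_eq_flip (μ := (volume : Measure (Rn d)))
      (ν := (volume : Measure (Rn d))) (L := innerₗ (Rn d)) (f := φ) (g := h)
      Real.continuous_fourierChar continuous_inner φ.integrable h1
    rw [flip_innerₗ] at this
    exact this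
  rw [e2, e3, ← e5, ← e4, e1]
  rfl

/-- Plancherel's formula for the Fourier integral on `L¹ ∩ L²`. -/
lemma lintegral_enorm_fourier_sq {h : Rn d → ℂ} (h1 : Integrable h) (h2 : MemLp h 2) :
    ∫⁻ ξ, ‖𝓕 h ξ‖ₑ ^ 2 = ∫⁻ x, ‖h x‖ₑ ^ 2 := by
  have e1 : ∫⁻ ξ, ‖𝓕 h ξ‖ₑ ^ 2 = ∫⁻ ξ, ‖fourierL2 d (h2.toLp h) ξ‖ₑ ^ 2 := by
    refine lintegral_congr_ae ?_
    filter_upwards [fourierL2_toLp_ae_eq h1 h2] with x hx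
    rw [hx]
  have e2 : ∫⁻ x, ‖h x‖ₑ ^ 2 = ∫⁻ x, ‖h2.toLp h x‖ₑ ^ 2 := by
    refine lintegral_congr_ae ?_
    filter_upwards [h2.coeFn_toLp] with x hx
    rw [hx]
  rw [e1, e2, lintegral_enorm_sq_eq, lintegral_enorm_sq_eq, LinearIsometryEquiv.norm_map]

end Plancherel

/-! ### Overlaps with moving packets -/

section PhaseSpace

variable {d : ℕ}

lemma lintegral_comp_smul_Rn {F : Rn d → ℝ≥0∞} (hF : Measurable F) :
    ∫⁻ p, F ((2 * Real.pi)⁻¹ • p) = ENNReal.ofReal ((2 * Real.pi) ^ d) * ∫⁻ ζ, F ζ := by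
  have hpi : (2 * Real.pi)⁻¹ ≠ 0 := by positivity
  rw [← lintegral_map hF (measurable_const_smul _), Measure.map_addHaar_smul _ hpi,
    lintegral_smul_measure, smul_eq_mul, finrank_euclideanSpace_fin, inv_pow, inv_inv,
    abs_of_pos (by positivity)]

lemma lintegral_flow_preimage (τ : ℝ) {g : Rn d × Rn d → ℝ≥0∞} (hg : Measurable g)
    {S : Set (Rn d)} (hS : MeasurableSet S) :
    ∫⁻ z in {z : Rn d × Rn d | z.1 + τ • z.2 ∈ S}, g z = ∫⁻ v in S, ∫⁻ p, g (v - τ • p, p) := by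
  have hset : MeasurableSet {z : Rn d × Rn d | z.1 + τ • z.2 ∈ S} :=
    (by fun_prop : Measurable fun z : Rn d × Rn d => z.1 + τ • z.2) hS
  have hm : Measurable fun z : Rn d × Rn d => S.indicator (fun v => g (v - τ • z.1, z.1)) z.2 :=
    (hg.comp (by fun_prop : Measurable fun z : Rn d × Rn d => (z.2 - τ • z.1, z.1))).indicator
      (measurable_snd hS)
  rw [← lintegral_indicator hset, Measure.volume_eq_prod,
    lintegral_prod_symm' _ (hg.indicator hset), ← lintegral_indicator hS]
  have e1 : ∀ p : Rn d, ∫⁻ x, {z : Rn d × Rn d | z.1 + τ • z.2 ∈ S}.indicator g (x, p) =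
      ∫⁻ v, S.indicator (fun v => g (v - τ • p, p)) v := by
    intro p
    rw [← lintegral_add_right_eq_self (S.indicator fun v => g (v - τ • p, p)) (τ • p)]
    refine lintegral_congr fun x => ?_
    simp [Set.indicator]
  simp only [e1]
  rw [lintegral_lintegral_swap hm.aemeasurable]
  refine lintegral_congr fun v => ?_
  by_cases hv : v ∈ S
  · simp [hv]
  · simp [hv]

namespace Profile

variable {κ : ℝ} (s : Profile d κ)

lemma packet_continuous (t : ℝ) :
    Continuous fun w : (Rn d × Rn d) × Rn d => s.packet t w.1.1 w.1.2 w.2 := by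
  simp only [packet_apply]
  have := s.wave_continuous t
  fun_prop

lemma inner_packet (t : ℝ) (x p : Rn d) (f : L2 d) :
    ⟪(s.packet t x p).toLp 2, f⟫_ℂ = ∫ y, (starRingEnd ℂ) (s.packet t x p y) * f y := by
  rw [L2.inner_def]
  refine integral_congr_ae ?_
  filter_upwards [SchwartzMap.coeFn_toLp (s.packet t x p) 2] with y hy
  rw [hy, RCLike.inner_apply, mul_comm]

lemma stronglyMeasurable_inner_packet (t : ℝ) (f : L2 d) :
    StronglyMeasurable fun z : Rn d × Rn d => ⟪(s.packet t z.1 z.2).toLp 2, f⟫_ℂ := by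
  simp only [inner_packet]
  refine StronglyMeasurable.integral_prod_right (f := fun (z : Rn d × Rn d) (y : Rn d) =>
    (starRingEnd ℂ) (s.packet t z.1 z.2 y) * f y) ?_
  exact (Complex.continuous_conj.comp (s.packet_continuous t)).stronglyMeasurable.mul
    ((Lp.stronglyMeasurable f).comp_measurable measurable_snd)

lemma memLp_conj_wave (t : ℝ) (v : Rn d) (q : ℝ≥0∞) :
    MemLp (fun y => (starRingEnd ℂ) (s.wave t (y - v))) q :=
  ((s.wave_memLp t q).comp_measurePreserving (measurePreserving_sub_right volume v)).star

/-- In the momentum `p`, the overlap with a moving packet is the Fourier transform of `f` seen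
through the window `wave t` centred at the classical position `x + 2tp`. -/
lemma enorm_inner_packet (t : ℝ) (x p : Rn d) (f : L2 d) :
    ‖⟪(s.packet t x p).toLp 2, f⟫_ℂ‖ₑ =
      ‖𝓕 (fun y => (starRingEnd ℂ) (s.wave t (y - (x + (2 * t) • p))) * f y)
        ((2 * Real.pi)⁻¹ • p)‖ₑ := by
  rw [inner_packet, Real.fourier_eq', ← ofReal_norm, ← ofReal_norm]
  have hc : ‖cexp (I * ((inner ℝ p x + t * ‖p‖ ^ 2 : ℝ) : ℂ))‖ = 1 := by
    rw [mul_comm, Complex.norm_exp_ofReal_mul_I]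
  rw [← one_mul (‖∫ v, cexp _ • _‖), ← hc, ← norm_mul, ← integral_const_mul]
  congr 3
  funext y
  have hexp : cexp ((starRingEnd ℂ) (I * ((inner ℝ p (y - x) - t * ‖p‖ ^ 2 : ℝ) : ℂ))) =
      cexp (I * ((inner ℝ p x + t * ‖p‖ ^ 2 : ℝ) : ℂ)) *
        cexp (((-2 * Real.pi * inner ℝ y ((2 * Real.pi)⁻¹ • p) : ℝ) : ℂ) * I) := by
    rw [← Complex.exp_add]
    congr 1
    have hpi' : (Real.pi : ℂ) ≠ 0 := by exact_mod_cast Real.pi_ne_zero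
    simp only [map_mul, Complex.conj_I, Complex.conj_ofReal, inner_sub_right, inner_smul_right,
      real_inner_comm p y]
    push_cast
    field_simp
    ring
  rw [packet_apply, map_mul, ← Complex.exp_conj, smul_eq_mul, hexp]
  ring

lemma lintegral_wave_ne_top (t : ℝ) : ∫⁻ u, ‖s.wave t u‖ₑ ^ 2 ≠ ∞ := by
  have h := lintegral_enorm_sq_eq ((s.wave_memLp t 2).toLp _)
  rw [lintegral_congr_ae (g := fun u => ‖s.wave t u‖ₑ ^ 2)] at h
  · rw [h]
    exact ENNReal.ofReal_ne_top
  · filter_upwards [(s.wave_memLp t 2).coeFn_toLp] with u hu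
    rw [hu]

/-- Plancherel's formula in phase space, in coordinates moving with the classical flow. -/
lemma lintegral_inner_packet (t : ℝ) (f : L2 d) {S : Set (Rn d)} (hS : MeasurableSet S) :
    ∫⁻ z in {z : Rn d × Rn d | z.1 + (2 * t) • z.2 ∈ S}, ‖⟪(s.packet t z.1 z.2).toLp 2, f⟫_ℂ‖ₑ ^ 2 =
      ENNReal.ofReal ((2 * Real.pi) ^ d) *
        ∫⁻ v in S, ∫⁻ y, ‖s.wave t (y - v)‖ₑ ^ 2 * ‖f y‖ₑ ^ 2 := by
  have hm : Measurable fun z : Rn d × Rn d => ‖⟪(s.packet t z.1 z.2).toLp 2, f⟫_ℂ‖ₑ ^ 2 :=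
    (s.stronglyMeasurable_inner_packet t f).measurable.enorm.pow_const 2
  rw [lintegral_flow_preimage (2 * t) hm hS, ← lintegral_const_mul' _ _ ENNReal.ofReal_ne_top]
  refine lintegral_congr fun v => ?_
  simp only [enorm_inner_packet, sub_add_cancel]
  have hL2 : MemLp (fun y => (starRingEnd ℂ) (s.wave t (y - v)) * f y) 2 :=
    (Lp.memLp f).mul (s.memLp_conj_wave t v ∞)
  have hL1 : Integrable (fun y => (starRingEnd ℂ) (s.wave t (y - v)) * f y) :=
    (s.memLp_conj_wave t v 2).integrable_mul (Lp.memLp f)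
  have hcont : Continuous (𝓕 fun y => (starRingEnd ℂ) (s.wave t (y - v)) * f y) :=
    VectorFourier.fourierIntegral_continuous Real.continuous_fourierChar continuous_inner hL1
  rw [lintegral_comp_smul_Rn (hcont.measurable.enorm.pow_const 2),
    lintegral_enorm_fourier_sq hL1 hL2]
  congr 1
  refine lintegral_congr fun y => ?_
  rw [enorm_mul, mul_pow, RCLike.enorm_conj]

lemma lintegral_inner_packet_univ (t : ℝ) (f : L2 d) :
    ∫⁻ z : Rn d × Rn d, ‖⟪(s.packet t z.1 z.2).toLp 2, f⟫_ℂ‖ₑ ^ 2 =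
      ENNReal.ofReal ((2 * Real.pi) ^ d) * ((∫⁻ u, ‖s.wave t u‖ₑ ^ 2) * ENNReal.ofReal (‖f‖ ^ 2)) := by
  have h := s.lintegral_inner_packet t f MeasurableSet.univ
  simp only [Set.mem_univ, Set.ofPred_true, Measure.restrict_univ] at h
  rw [h, lintegral_lintegral_swap]
  · congr 1
    rw [← lintegral_enorm_sq_eq, ← lintegral_const_mul']
    · refine lintegral_congr fun y => ?_
      rw [lintegral_mul_const', lintegral_sub_left_eq_self (fun u => ‖s.wave t u‖ₑ ^ 2) y]
      exact ENNReal.pow_ne_top enorm_ne_top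
    · exact s.lintegral_wave_ne_top t
  · have := s.wave_continuous t
    have h1 : Measurable fun w : Rn d × Rn d => s.wave t (w.2 - w.1) :=
      Continuous.measurable (by fun_prop)
    exact ((h1.enorm.pow_const 2).mul
      (((Lp.stronglyMeasurable f).measurable.comp measurable_snd).enorm.pow_const 2)).aemeasurable

/-- If `f` lives in `A` and the classical flow carries `E` to a set at distance at least `ρ` from
`A`, the overlap of `f` with the packets evolved from `E` is controlled by the tail of the wave. -/
lemma lintegral_inner_packet_le (t : ℝ) (f : L2 d) {S A : Set (Rn d)} {E : Set (Rn d × Rn d)}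
    (hS : MeasurableSet S) (hE : ∀ z ∈ E, z.1 + (2 * t) • z.2 ∈ S) (hf : ∀ᵐ y, y ∉ A → f y = 0)
    {ρ : ℝ} (hρ : ∀ y ∈ A, ∀ v ∈ S, ρ ≤ ‖y - v‖) :
    ∫⁻ z in E, ‖⟪(s.packet t z.1 z.2).toLp 2, f⟫_ℂ‖ₑ ^ 2 ≤
      ENNReal.ofReal ((2 * Real.pi) ^ d) *
        ((∫⁻ u in {u | ρ ≤ ‖u‖}, ‖s.wave t u‖ₑ ^ 2) * ENNReal.ofReal (‖f‖ ^ 2)) := by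
  have hE' : E ⊆ {z : Rn d × Rn d | z.1 + (2 * t) • z.2 ∈ S} := hE
  refine (lintegral_mono_set hE').trans ?_
  rw [s.lintegral_inner_packet t f hS]
  refine mul_le_mul_right ?_ _
  have hc := s.wave_continuous t
  have hmeas : MeasurableSet {u : Rn d | ρ ≤ ‖u‖} :=
    measurableSet_le measurable_const measurable_norm
  rw [lintegral_lintegral_swap, ← lintegral_enorm_sq_eq, ← lintegral_const_mul']
  · refine lintegral_mono_ae ?_
    filter_upwards [hf] with y hy
    by_cases hyA : y ∈ A
    · rw [lintegral_mul_const' _ _ (ENNReal.pow_ne_top enorm_ne_top)]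
      refine mul_le_mul_left ?_ _
      rw [← lintegral_indicator hS, ← lintegral_indicator hmeas,
        ← lintegral_sub_left_eq_self
          ({u : Rn d | ρ ≤ ‖u‖}.indicator fun u => ‖s.wave t u‖ₑ ^ 2) y]
      refine lintegral_mono fun v => ?_
      by_cases hv : v ∈ S
      · simp [Set.indicator, hv, hρ y hyA v hv]
      · simp [hv]
    · simp [hy hyA]
  · exact ((setLIntegral_le_lintegral _ _).trans_lt (s.lintegral_wave_ne_top t).lt_top).ne
  · have h1 : Measurable fun w : Rn d × Rn d => s.wave t (w.2 - w.1) :=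
      Continuous.measurable (by fun_prop)
    exact ((h1.enorm.pow_const 2).mul
      (((Lp.stronglyMeasurable f).measurable.comp measurable_snd).enorm.pow_const 2)).aemeasurable

end Profile

end PhaseSpace

/-! ### Unitary groups and Cook's method -/

section Cook

variable {X : Type*} [NormedAddCommGroup X] [InnerProductSpace ℂ X]

namespace IsUnitaryGroup

variable {U : ℝ → X →L[ℂ] X}

lemma apply_neg_apply (hU : IsUnitaryGroup U) (t : ℝ) (x : X) : U t (U (-t) x) = x := by
  rw [← hU.add, add_neg_cancel, hU.zero]

lemma inner_neg_left (hU : IsUnitaryGroup U) (t : ℝ) (x y : X) :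
    ⟪U (-t) x, y⟫_ℂ = ⟪x, U t y⟫_ℂ := by
  have h := (LinearMap.norm_map_iff_inner_map_map (𝕜 := ℂ) (U t)).1 (hU.norm_map t) (U (-t) x) y
  rw [hU.apply_neg_apply] at h
  exact h.symm

lemma adjoint_eq [CompleteSpace X] (hU : IsUnitaryGroup U) (t : ℝ) :
    ContinuousLinearMap.adjoint (U t) = U (-t) := by
  symm
  rw [ContinuousLinearMap.eq_adjoint_iff]
  exact hU.inner_neg_left t

end IsUnitaryGroup

variable {H₀ : X →ₗ.[ℂ] X} {G U : ℝ → X →L[ℂ] X} {V : X →L[ℂ] X}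

/-- A propagator leaves the domain of its generator invariant and commutes with the generator. -/
lemma IsPropagator.apply_mem_domain (hG : IsPropagator H₀ G) {ψ : X} (hψ : ψ ∈ H₀.domain) (t : ℝ) :
    ∃ h : G t ψ ∈ H₀.domain, H₀ ⟨G t ψ, h⟩ = G t (H₀ ⟨ψ, hψ⟩) := by
  rw [hG.generator]
  have h := ((G t).continuous.tendsto _).comp ((hG.generator ψ _).1 ⟨hψ, rfl⟩)
  simp only [map_neg, map_smul] at h
  refine h.congr fun r => ?_
  simp only [Function.comp, map_smul, map_sub, ← hG.add, add_comm]

/-- The derivative on which Cook's method rests. -/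
lemma IsPropagator.hasDerivAt_interaction (hG : IsPropagator H₀ G)
    (hU : IsPropagator ((V : X →ₗ[ℂ] X) +ᵥ H₀) U) {ψ : X} (hψ : ψ ∈ H₀.domain) (t : ℝ) :
    HasDerivAt (fun t => U (-t) (G t ψ)) (I • U (-t) (V (G t ψ))) t := by
  obtain ⟨hy, hHy⟩ := hG.apply_mem_domain hψ t
  set y := G t ψ with hydef
  have h1 : Tendsto (fun h : ℝ => (h : ℂ)⁻¹ • (G h y - y)) (𝓝[≠] 0) (𝓝 (-(I • H₀ ⟨y, hy⟩))) :=
    (hG.generator y _).1 ⟨hy, rfl⟩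
  have h2 : Tendsto (fun h : ℝ => (h : ℂ)⁻¹ • (U h y - y)) (𝓝[≠] 0)
      (𝓝 (-(I • (V y + H₀ ⟨y, hy⟩)))) :=
    (hU.generator y _).1 ⟨hy, by simp [LinearPMap.vadd_apply]⟩
  have hneg : Tendsto (fun h : ℝ => -h) (𝓝[≠] 0) (𝓝[≠] 0) := by
    refine tendsto_nhdsWithin_iff.2 ⟨?_, ?_⟩
    · have : Tendsto (fun h : ℝ => -h) (𝓝 0) (𝓝 (-0)) := continuous_neg.tendsto 0
      rw [neg_zero] at this
      exact this.mono_left nhdsWithin_le_nhds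
    · filter_upwards [self_mem_nhdsWithin] with h hh
      simpa using hh
  have h3 := ((U (-t)).continuous.tendsto _).comp (h2.comp hneg)
  have h4 : Tendsto (fun h : ℝ => U (-t - h) ((h : ℂ)⁻¹ • (G h y - y))) (𝓝[≠] 0)
      (𝓝 (U (-t) (-(I • H₀ ⟨y, hy⟩)))) := by
    have hp : Tendsto (fun h : ℝ => ((-t - h, (h : ℂ)⁻¹ • (G h y - y)) : ℝ × X)) (𝓝[≠] 0)
        (𝓝 (-t, -(I • H₀ ⟨y, hy⟩))) := by
      refine Tendsto.prodMk_nhds ?_ h1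
      have : Tendsto (fun h : ℝ => -t - h) (𝓝 0) (𝓝 (-t - 0)) :=
        (continuous_const.sub continuous_id).tendsto 0
      rw [sub_zero] at this
      exact this.mono_left nhdsWithin_le_nhds
    exact (hU.continuous_uncurry.tendsto _).comp hp
  have h5 := h4.sub h3
  rw [hasDerivAt_iff_tendsto_slope_zero]
  convert! h5 using 1
  · funext h
    have e1 : G (t + h) ψ = G h y := by rw [add_comm, hG.add]
    have e2 : -(t + h) = -t + -h := by ring
    have e3 : -t - h = -t + -h := by ring
    simp only [Function.comp, e1, ← hydef, ← Complex.coe_smul, Complex.ofReal_inv, map_smul, map_sub,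
      Complex.ofReal_neg, inv_neg, neg_smul, map_neg, e2, e3, hU.add, smul_sub]
    abel
  · congr 1
    simp only [map_neg, map_smul, map_add, smul_add]
    abel

/-- Cook's estimate. -/
lemma IsPropagator.norm_interaction_sub_le [CompleteSpace X] (hG : IsPropagator H₀ G)
    (hU : IsPropagator ((V : X →ₗ[ℂ] X) +ᵥ H₀) U) (hD : Dense (H₀.domain : Set X)) (ψ : X)
    {a b : ℝ} (hab : a ≤ b) :
    ‖U (-b) (G b ψ) - U (-a) (G a ψ)‖ ≤ ∫ r in a..b, ‖V (G r ψ)‖ := by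
  have hGc := hG.continuous_uncurry
  have hUc := hU.continuous_uncurry
  have hcl : IsClosed {ψ : X | ‖U (-b) (G b ψ) - U (-a) (G a ψ)‖ ≤ ∫ r in a..b, ‖V (G r ψ)‖} := by
    refine isClosed_le (by fun_prop) ?_
    refine intervalIntegral.continuous_parametric_intervalIntegral_of_continuous' ?_ a b
    exact (V.continuous.comp (hGc.comp continuous_swap)).norm
  refine hcl.closure_subset_iff.2 (fun ψ hψ => ?_) (hD ψ)
  have hd := fun t => hG.hasDerivAt_interaction hU hψ t
  have hcont : Continuous fun t : ℝ => I • U (-t) (V (G t ψ)) :=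
    (hUc.comp (continuous_neg.prodMk (V.continuous.comp (hG.strong_cont ψ)))).const_smul I
  have h := intervalIntegral.integral_eq_sub_of_hasDerivAt (fun t _ => hd t)
    (hcont.intervalIntegrable a b)
  simp only [Set.mem_ofPred_eq]
  rw [← h]
  refine (intervalIntegral.norm_integral_le_integral_norm hab).trans (le_of_eq ?_)
  simp [norm_smul, hU.norm_map]

lemma integral_inv_sq_le {K c a b : ℝ} (hK : 0 ≤ K) (ha : 0 < c + a) (hab : a ≤ b) :
    ∫ r in a..b, K * ((c + r) ^ 2)⁻¹ ≤ K * (c + a)⁻¹ := by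
  have hd : ∀ r ∈ Set.uIcc a b, HasDerivAt (fun r : ℝ => -(K * (c + r)⁻¹)) (K * ((c + r) ^ 2)⁻¹) r := by
    intro r hr
    rw [Set.uIcc_of_le hab] at hr
    have hr0 : c + r ≠ 0 := by linarith [hr.1]
    have := ((((hasDerivAt_id r).const_add c).inv hr0).const_mul K).neg
    convert! this using 1
    simp [div_eq_mul_inv]
  rw [intervalIntegral.integral_eq_sub_of_hasDerivAt hd]
  · have : 0 ≤ K * (c + b)⁻¹ := mul_nonneg hK (inv_nonneg.2 (by linarith))
    linarith
  · refine ContinuousOn.intervalIntegrable fun r hr => ?_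
    rw [Set.uIcc_of_le hab] at hr
    have hr0 : (c + r) ^ 2 ≠ 0 := pow_ne_zero 2 (by linarith [hr.1])
    exact ContinuousAt.continuousWithinAt (by fun_prop (disch := exact hr0))

/-- Cook's estimate for an interaction decaying like `1 / t ^ 2`, in the time direction `σ`. -/
lemma IsPropagator.norm_interaction_sub_le_of_decay [CompleteSpace X] (hG : IsPropagator H₀ G)
    (hU : IsPropagator ((V : X →ₗ[ℂ] X) +ᵥ H₀) U) (hD : Dense (H₀.domain : Set X)) {ψ : X}
    {σ : ℝ} (hσ : σ = 1 ∨ σ = -1) {K c T : ℝ} (hK : 0 ≤ K) (hT : 0 < c + T)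
    (hV : ∀ r, T ≤ r → ‖V (G (σ * r) ψ)‖ ≤ K * ((c + r) ^ 2)⁻¹) {a b : ℝ} (ha : T ≤ a)
    (hab : a ≤ b) :
    ‖U (-(σ * b)) (G (σ * b) ψ) - U (-(σ * a)) (G (σ * a) ψ)‖ ≤ K * (c + a)⁻¹ := by
  have h1 : ‖U (-(σ * b)) (G (σ * b) ψ) - U (-(σ * a)) (G (σ * a) ψ)‖ ≤
      ∫ r in a..b, ‖V (G (σ * r) ψ)‖ := by
    rcases hσ with rfl | rfl
    · simpa using hG.norm_interaction_sub_le hU hD ψ hab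
    · have h := hG.norm_interaction_sub_le hU hD ψ (neg_le_neg hab)
      rw [norm_sub_rev] at h
      have e : ∫ r in (-b)..(-a), ‖V (G r ψ)‖ = ∫ r in a..b, ‖V (G (-1 * r) ψ)‖ := by
        rw [← intervalIntegral.integral_comp_neg]
        simp
      rw [e] at h
      simpa using h
  refine h1.trans ((intervalIntegral.integral_mono_on hab ?_ ?_ fun r hr =>
    hV r (ha.trans hr.1)).trans (integral_inv_sq_le hK (by linarith) hab))
  · refine Continuous.intervalIntegrable ?_ a b
    exact (V.continuous.comp ((hG.strong_cont ψ).comp (continuous_const.mul continuous_id))).norm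
  · refine ContinuousOn.intervalIntegrable fun r hr => ?_
    rw [Set.uIcc_of_le hab] at hr
    have hr0 : (c + r) ^ 2 ≠ 0 := pow_ne_zero 2 (by linarith [hr.1])
    exact ContinuousAt.continuousWithinAt (by fun_prop (disch := exact hr0))

/-- Cook's criterion for the convergence of `e^{itH} e^{-itH₀} ψ`. -/
lemma IsPropagator.cauchySeq_interaction [CompleteSpace X] (hG : IsPropagator H₀ G)
    (hU : IsPropagator ((V : X →ₗ[ℂ] X) +ᵥ H₀) U) (hD : Dense (H₀.domain : Set X)) {ψ : X}
    {σ : ℝ} (hσ : σ = 1 ∨ σ = -1) {K T : ℝ} (hK : 0 ≤ K) (hT : 0 < T)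
    (hV : ∀ r, T ≤ r → ‖V (G (σ * r) ψ)‖ ≤ K * (r ^ 2)⁻¹) :
    CauchySeq fun t : ℝ => U (-(σ * t)) (G (σ * t) ψ) := by
  rw [Metric.cauchySeq_iff']
  intro ε hε
  refine ⟨max T (K / ε + 1), fun t ht => ?_⟩
  set a := max T (K / ε + 1) with ha
  have ha0 : 0 < a := hT.trans_le (le_max_left _ _)
  have h := hG.norm_interaction_sub_le_of_decay hU hD hσ (c := 0) hK (by simpa using hT)
    (by simpa using hV) (le_max_left T (K / ε + 1)) ht
  rw [dist_eq_norm]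
  refine h.trans_lt ?_
  rw [zero_add, ← div_eq_mul_inv, div_lt_iff₀ ha0]
  have h3 : K / ε + 1 ≤ a := le_max_right _ _
  have h4 : K = ε * (K / ε) := by field_simp
  nlinarith

/-- The distance of the limit of `e^{itH} e^{-itH₀} ψ` from `ψ`. -/
lemma IsPropagator.norm_limit_sub_le [CompleteSpace X] (hG : IsPropagator H₀ G)
    (hU : IsPropagator ((V : X →ₗ[ℂ] X) +ᵥ H₀) U) (hD : Dense (H₀.domain : Set X)) {ψ χ : X}
    {σ : ℝ} (hσ : σ = 1 ∨ σ = -1) {K c : ℝ} (hK : 0 ≤ K) (hc : 0 < c)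
    (hV : ∀ r, 0 ≤ r → ‖V (G (σ * r) ψ)‖ ≤ K * ((c + r) ^ 2)⁻¹)
    (hχ : Tendsto (fun t : ℝ => U (-(σ * t)) (G (σ * t) ψ)) atTop (𝓝 χ)) :
    ‖χ - ψ‖ ≤ K * c⁻¹ := by
  refine le_of_tendsto (hχ.sub_const ψ).norm ?_
  filter_upwards [eventually_ge_atTop 0] with t ht
  have h := hG.norm_interaction_sub_le_of_decay hU hD hσ hK (by simpa using hc) hV le_rfl ht
  simpa [hG.zero, hU.zero] using h

/-- A family of isometries that converges on a total set converges strongly. -/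
lemma exists_strong_limit [CompleteSpace X] {W : ℝ → X →L[ℂ] X} (hW : ∀ t x, ‖W t x‖ = ‖x‖)
    (hconv : ∀ φ, (∀ ψ, CauchySeq (fun t => W t ψ) → ⟪ψ, φ⟫_ℂ = 0) → φ = 0) :
    ∃ Ω : X →L[ℂ] X, ∀ ψ, Tendsto (fun t => W t ψ) atTop (𝓝 (Ω ψ)) := by
  let D : Submodule ℂ X :=
    { carrier := {ψ | ∃ y, Tendsto (fun t => W t ψ) atTop (𝓝 y)}
      add_mem' := fun {a b} ⟨y, hy⟩ ⟨z, hz⟩ => ⟨y + z, by simpa only [map_add] using hy.add hz⟩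
      zero_mem' := ⟨0, by simp⟩
      smul_mem' := fun c a ⟨y, hy⟩ => ⟨c • y, by simpa only [map_smul] using hy.const_smul c⟩ }
  have hDmem : ∀ ψ, ψ ∈ D ↔ CauchySeq fun t => W t ψ := fun ψ =>
    ⟨fun ⟨_, hy⟩ => hy.cauchySeq, cauchySeq_tendsto_of_complete⟩
  have hclosed : IsClosed (D : Set X) := by
    refine isClosed_of_closure_subset fun ψ hψ => ?_
    rw [SetLike.mem_coe, hDmem, Metric.cauchySeq_iff']
    intro ε hε
    obtain ⟨ψ', hψ', hd⟩ := Metric.mem_closure_iff.1 hψ (ε / 3) (by positivity)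
    obtain ⟨N, hN⟩ := Metric.cauchySeq_iff'.1 ((hDmem ψ').1 hψ') (ε / 3) (by positivity)
    refine ⟨N, fun t ht => ?_⟩
    have h0 : ∀ t, dist (W t ψ) (W t ψ') = dist ψ ψ' := fun t => by
      rw [dist_eq_norm, ← map_sub, hW, dist_eq_norm]
    have h1 := dist_triangle4 (W t ψ) (W t ψ') (W N ψ') (W N ψ)
    rw [h0, dist_comm (W N ψ'), h0] at h1
    linarith [hN t ht]
  have htop : D = ⊤ := by
    have : CompleteSpace D := hclosed.completeSpace_coe
    rw [← Submodule.orthogonal_eq_bot_iff, Submodule.eq_bot_iff]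
    intro φ hφ
    exact hconv φ fun ψ hψ => (Submodule.mem_orthogonal _ _).1 hφ ψ ((hDmem ψ).2 hψ)
  have hex : ∀ ψ, ∃ y, Tendsto (fun t => W t ψ) atTop (𝓝 y) := fun ψ =>
    (htop ▸ Submodule.mem_top : ψ ∈ D)
  choose Ω hΩ using hex
  refine ⟨LinearMap.mkContinuous
    { toFun := Ω
      map_add' := fun x y => tendsto_nhds_unique (hΩ (x + y))
        (by simpa only [map_add] using (hΩ x).add (hΩ y))
      map_smul' := fun c x => tendsto_nhds_unique (hΩ (c • x))
        (by simpa only [map_smul, RingHom.id_apply] using (hΩ x).const_smul c) } 1 (fun ψ => ?_), hΩ⟩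
  have h := (hΩ ψ).norm
  simp only [hW] at h
  rw [one_mul]
  exact (tendsto_nhds_unique h tendsto_const_nhds).le

end Cook

/-! ### Phase space localization -/

section Localization

variable {d : ℕ} {κ : ℝ} (s : Profile d κ) (E : Set (Rn d × Rn d))

lemma memLp_two_of_lintegral_ne_top {α : Type*} [MeasurableSpace α] {μ : Measure α} {g : α → ℂ}
    (hg : AEStronglyMeasurable g μ) (h : ∫⁻ x, ‖g x‖ₑ ^ 2 ∂μ ≠ ∞) : MemLp g 2 μ := by
  refine ⟨hg, ?_⟩
  rw [eLpNorm_lt_top_iff_lintegral_rpow_enorm_lt_top two_ne_zero ENNReal.ofNat_ne_top]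
  simpa using h.lt_top

namespace Profile

/-- The coherent state `η_{x,p}` as a vector of `L²(ℝᵈ)`, for `z = (x, p)`. -/
noncomputable def state (z : Rn d × Rn d) : L2 d := (s.packet 0 z.1 z.2).toLp 2

lemma stronglyMeasurable_inner_state (f : L2 d) :
    StronglyMeasurable fun z => ⟪s.state z, f⟫_ℂ :=
  s.stronglyMeasurable_inner_packet 0 f

lemma lintegral_inner_state (f : L2 d) : ∫⁻ z, ‖⟪s.state z, f⟫_ℂ‖ₑ ^ 2 =
    ENNReal.ofReal ((2 * Real.pi) ^ d) * ((∫⁻ u, ‖s.wave 0 u‖ₑ ^ 2) * ENNReal.ofReal (‖f‖ ^ 2)) :=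
  s.lintegral_inner_packet_univ 0 f

lemma memLp_inner_state (f : L2 d) :
    MemLp (fun z => ⟪s.state z, f⟫_ℂ) 2 (volume.restrict E) := by
  refine MemLp.restrict E (memLp_two_of_lintegral_ne_top
    (s.stronglyMeasurable_inner_state f).aestronglyMeasurable ?_)
  rw [lintegral_inner_state]
  exact ENNReal.mul_ne_top ENNReal.ofReal_ne_top
    (ENNReal.mul_ne_top (s.lintegral_wave_ne_top 0) ENNReal.ofReal_ne_top)

lemma norm_toLp_inner_state_sq (f : L2 d) :
    ENNReal.ofReal (‖(s.memLp_inner_state E f).toLp _‖ ^ 2) =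
      ∫⁻ z in E, ‖⟪s.state z, f⟫_ℂ‖ₑ ^ 2 := by
  rw [← lintegral_enorm_sq_eq]
  refine lintegral_congr_ae ?_
  filter_upwards [(s.memLp_inner_state E f).coeFn_toLp] with z hz
  rw [hz]

/-- The analysis operator `f ↦ (z ↦ ⟨η_z, f⟩)` from `L²(ℝᵈ)` to `L²(E)`. -/
noncomputable def analysis : L2 d →L[ℂ] Lp ℂ 2 (volume.restrict E) :=
  LinearMap.mkContinuous
    { toFun := fun f => (s.memLp_inner_state E f).toLp _
      map_add' := fun f g => by
        rw [← MemLp.toLp_add]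
        exact MemLp.toLp_congr _ _ (.of_forall fun z => inner_add_right _ _ _)
      map_smul' := fun c f => by
        rw [RingHom.id_apply, ← MemLp.toLp_const_smul]
        exact MemLp.toLp_congr _ _ (.of_forall fun z => inner_smul_right _ _ _) }
    (√((2 * Real.pi) ^ d * (∫⁻ u, ‖s.wave 0 u‖ₑ ^ 2).toReal)) (fun f => by
      refine abs_le_of_sq_le_sq' ?_ (by positivity) |>.2
      rw [mul_pow, Real.sq_sqrt (by positivity),
        ← ENNReal.ofReal_le_ofReal_iff (by positivity)]
      refine (s.norm_toLp_inner_state_sq E f).trans_le ((setLIntegral_le_lintegral _ _).trans ?_)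
      rw [lintegral_inner_state, ENNReal.ofReal_mul (by positivity),
        ENNReal.ofReal_mul (by positivity), ENNReal.ofReal_toReal (s.lintegral_wave_ne_top 0),
        mul_assoc])

lemma analysis_coeFn (f : L2 d) :
    s.analysis E f =ᵐ[volume.restrict E] fun z => ⟪s.state z, f⟫_ℂ :=
  (s.memLp_inner_state E f).coeFn_toLp

lemma norm_analysis_sq (f : L2 d) : ENNReal.ofReal (‖s.analysis E f‖ ^ 2) =
    ∫⁻ z in E, ‖⟪s.state z, f⟫_ℂ‖ₑ ^ 2 :=
  s.norm_toLp_inner_state_sq E f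

lemma integrableOn_overlap (f g : L2 d) :
    IntegrableOn (fun z => (starRingEnd ℂ) ⟪s.state z, f⟫_ℂ * ⟪s.state z, g⟫_ℂ) E :=
  (s.memLp_inner_state E f).star.integrable_mul (s.memLp_inner_state E g)

lemma inner_analysis (f g : L2 d) : ⟪s.analysis E f, s.analysis E g⟫_ℂ =
    ∫ z in E, (starRingEnd ℂ) ⟪s.state z, f⟫_ℂ * ⟪s.state z, g⟫_ℂ := by
  rw [L2.inner_def]
  refine integral_congr_ae ?_
  filter_upwards [s.analysis_coeFn E f, s.analysis_coeFn E g] with z h1 h2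
  rw [h1, h2, RCLike.inner_apply, mul_comm]

/-- The phase space localization `P(E) = (2π)^{-d} T_E* T_E`, with `T_E` the analysis operator. -/
noncomputable def localization : L2 d →L[ℂ] L2 d :=
  ((((2 * Real.pi) ^ d)⁻¹ : ℝ) : ℂ) •
    (ContinuousLinearMap.adjoint (s.analysis E) ∘L s.analysis E)

lemma inner_localization (f g : L2 d) : ⟪f, s.localization E g⟫_ℂ =
    ((((2 * Real.pi) ^ d)⁻¹ : ℝ) : ℂ) *
      ∫ z in E, (starRingEnd ℂ) ⟪s.state z, f⟫_ℂ * ⟪s.state z, g⟫_ℂ := by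
  rw [localization, smul_apply, inner_smul_right,
    ContinuousLinearMap.comp_apply, ContinuousLinearMap.adjoint_inner_right, inner_analysis]

lemma localization_adjoint : ContinuousLinearMap.adjoint (s.localization E) = s.localization E := by
  symm
  rw [ContinuousLinearMap.eq_adjoint_iff]
  intro f g
  simp only [localization, smul_apply, inner_smul_right, inner_smul_left,
    ContinuousLinearMap.comp_apply, ContinuousLinearMap.adjoint_inner_right,
    ContinuousLinearMap.adjoint_inner_left, Complex.conj_ofReal]

lemma localization_union {A B : Set (Rn d × Rn d)} (hAB : Disjoint A B) (hB : MeasurableSet B)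
    (f : L2 d) : s.localization (A ∪ B) f = s.localization A f + s.localization B f := by
  refine ext_inner_left ℂ fun g => ?_
  rw [inner_add_right, inner_localization, inner_localization, inner_localization,
    setIntegral_union hAB hB (s.integrableOn_overlap A g f) (s.integrableOn_overlap B g f), mul_add]

lemma norm_analysis_univ_sq (hs : ∫⁻ u, ‖s.wave 0 u‖ₑ ^ 2 = 1) (f : L2 d) :
    ‖s.analysis Set.univ f‖ ^ 2 = (2 * Real.pi) ^ d * ‖f‖ ^ 2 := by
  rw [← ENNReal.ofReal_eq_ofReal_iff (by positivity) (by positivity), norm_analysis_sq,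
    Measure.restrict_univ, lintegral_inner_state, hs, one_mul, ENNReal.ofReal_mul (by positivity)]

lemma norm_analysis_sq_le (hs : ∫⁻ u, ‖s.wave 0 u‖ₑ ^ 2 = 1) (f : L2 d) :
    ‖s.analysis E f‖ ^ 2 ≤ (2 * Real.pi) ^ d * ‖f‖ ^ 2 := by
  rw [← s.norm_analysis_univ_sq hs, ← ENNReal.ofReal_le_ofReal_iff (by positivity),
    norm_analysis_sq, norm_analysis_sq, Measure.restrict_univ]
  exact setLIntegral_le_lintegral _ _

/-- The coherent states resolve the identity. -/
lemma localization_univ (hs : ∫⁻ u, ‖s.wave 0 u‖ₑ ^ 2 = 1) (f : L2 d) : s.localization Set.univ f = f := by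
  have h : s.localization Set.univ = ContinuousLinearMap.id ℂ (L2 d) := by
    rw [← sub_eq_zero]
    refine ContinuousLinearMap.coe_injective ?_
    rw [ContinuousLinearMap.toLinearMap_zero, ← inner_map_self_eq_zero]
    intro f
    have h1 := s.norm_analysis_univ_sq hs f
    have h2 : ((‖s.analysis Set.univ f‖ ^ 2 : ℝ) : ℂ) = (((2 * Real.pi) ^ d * ‖f‖ ^ 2 : ℝ) : ℂ) :=
      congrArg _ h1
    simp only [ContinuousLinearMap.toLinearMap_sub, LinearMap.sub_apply, ContinuousLinearMap.coe_coe,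
      inner_sub_left, localization, smul_apply, inner_smul_left,
      ContinuousLinearMap.comp_apply, ContinuousLinearMap.adjoint_inner_left,
      ContinuousLinearMap.coe_id', id_eq, inner_self_eq_norm_sq_to_K, Complex.conj_ofReal]
    have hpi : ((2 * Real.pi) ^ d : ℝ) ≠ 0 := by positivity
    have hpi' : (((2 * Real.pi) ^ d : ℝ) : ℂ) ≠ 0 := by exact_mod_cast hpi
    rw [sub_eq_zero, Complex.ofReal_inv, inv_mul_eq_iff_eq_mul₀ hpi']
    push_cast at h2 ⊢
    exact h2
  rw [h]
  rfl

lemma localization_add_compl (hs : ∫⁻ u, ‖s.wave 0 u‖ₑ ^ 2 = 1) {A : Set (Rn d × Rn d)}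
    (hA : MeasurableSet A) (f : L2 d) : s.localization A f + s.localization Aᶜ f = f := by
  rw [← s.localization_union disjoint_compl_right hA.compl, Set.union_compl_self,
    s.localization_univ hs]

lemma norm_localization_le_of_lintegral (hs : ∫⁻ u, ‖s.wave 0 u‖ₑ ^ 2 = 1) {f : L2 d}
    {a : ℝ} (ha : 0 ≤ a)
    (h : ∫⁻ z in E, ‖⟪s.state z, f⟫_ℂ‖ₑ ^ 2 ≤ ENNReal.ofReal ((2 * Real.pi) ^ d * a ^ 2)) :
    ‖s.localization E f‖ ≤ a := by
  set c : ℝ := (2 * Real.pi) ^ d with hc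
  have hc0 : 0 < c := by positivity
  set g := s.localization E f with hg
  rw [← norm_analysis_sq, ENNReal.ofReal_le_ofReal_iff (by positivity)] at h
  have h1 := s.norm_analysis_sq_le E hs g
  have h2 : c * ‖g‖ ^ 2 ≤ ‖s.analysis E g‖ * ‖s.analysis E f‖ := by
    have e : ⟪g, g⟫_ℂ = ((c⁻¹ : ℝ) : ℂ) * ⟪s.analysis E g, s.analysis E f⟫_ℂ := by
      conv_lhs => rw [hg]
      rw [inner_localization, inner_analysis]
    have e2 := congrArg norm e
    rw [inner_self_eq_norm_sq_to_K, norm_mul, Complex.norm_real, Real.norm_eq_abs,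
      abs_of_pos (inv_pos.2 hc0), norm_pow, RCLike.norm_ofReal, abs_norm] at e2
    rw [e2, ← mul_assoc, mul_inv_cancel₀ hc0.ne', one_mul]
    exact norm_inner_le_norm _ _
  have h3 : (c * ‖g‖ ^ 2) ^ 2 ≤ (c * ‖g‖ ^ 2) * (c * a ^ 2) := by
    calc (c * ‖g‖ ^ 2) ^ 2 ≤ (‖s.analysis E g‖ * ‖s.analysis E f‖) ^ 2 := by gcongr
      _ = ‖s.analysis E g‖ ^ 2 * ‖s.analysis E f‖ ^ 2 := by ring
      _ ≤ _ := by gcongr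
  rcases (norm_nonneg g).eq_or_lt with h0 | h0
  · rw [← h0]; exact ha
  · rw [sq (c * _)] at h3
    have h4 := le_of_mul_le_mul_left h3 (by positivity)
    exact abs_le_of_sq_le_sq' (le_of_mul_le_mul_left h4 hc0) ha |>.2

lemma norm_localization_le (hs : ∫⁻ u, ‖s.wave 0 u‖ₑ ^ 2 = 1) (f : L2 d) :
    ‖s.localization E f‖ ≤ ‖f‖ := by
  refine s.norm_localization_le_of_lintegral E hs (norm_nonneg f) ?_
  rw [← norm_analysis_sq]
  exact ENNReal.ofReal_le_ofReal (s.norm_analysis_sq_le E hs f)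

/-- A vector living in `A`, evolved back by the free dynamics, has little weight on a set of
phase space that the classical flow carries to distance at least `ρ` from `A`. -/
lemma norm_localization_freePropagator_le (hs : ∫⁻ u, ‖s.wave 0 u‖ₑ ^ 2 = 1) {t : ℝ}
    {f : L2 d} {S A : Set (Rn d)} {E : Set (Rn d × Rn d)} (hS : MeasurableSet S) (hE : ∀ z ∈ E, z.1 + (2 * t) • z.2 ∈ S)
    (hf : ∀ᵐ y, y ∉ A → f y = 0) {ρ a : ℝ} (hρ : ∀ y ∈ A, ∀ v ∈ S, ρ ≤ ‖y - v‖) (ha : 0 ≤ a)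
    (htail : ∫⁻ u in {u | ρ ≤ ‖u‖}, ‖s.wave t u‖ₑ ^ 2 ≤ ENNReal.ofReal (a ^ 2)) :
    ‖s.localization E (freePropagator d (-t) f)‖ ≤ a * ‖f‖ := by
  refine s.norm_localization_le_of_lintegral E hs (by positivity) ?_
  have e : ∀ z, ⟪s.state z, freePropagator d (-t) f⟫_ℂ =
      ⟪(s.packet t z.1 z.2).toLp 2, f⟫_ℂ := by
    intro z
    have h := (freePropagator_isPropagator (n := d)).toIsUnitaryGroup.inner_neg_left (-t)
      (s.state z) f
    rw [← h, neg_neg, state, freePropagator_packet, zero_add]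
  simp only [e]
  refine (s.lintegral_inner_packet_le t f hS hE hf hρ).trans ?_
  rw [mul_pow a, ENNReal.ofReal_mul (by positivity), ENNReal.ofReal_mul (by positivity)]
  gcongr

end Profile

end Localization

/-! ### Geometry of the surface and the window profile -/

section Geometry

variable {k l : ℕ}

lemma transverse_add (x y : Rn (k + l)) :
    transverse (x + y) = transverse x + transverse y := rfl

lemma transverse_sub (x y : Rn (k + l)) :
    transverse (x - y) = transverse x - transverse y := rfl

lemma transverse_smul (c : ℝ) (x : Rn (k + l)) : transverse (c • x) = c • transverse x := rfl

lemma norm_sq_eq_longitudinal_add_transverse (x : Rn (k + l)) :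
    ‖x‖ ^ 2 = ‖longitudinal x‖ ^ 2 + ‖transverse x‖ ^ 2 := by
  simp only [EuclideanSpace.norm_sq_eq, Fin.sum_univ_add]
  rfl

lemma norm_transverse_le (x : Rn (k + l)) : ‖transverse x‖ ≤ ‖x‖ := by
  refine abs_le_of_sq_le_sq' ?_ (norm_nonneg _) |>.2
  rw [norm_sq_eq_longitudinal_add_transverse]
  nlinarith [norm_nonneg (longitudinal x)]

lemma continuous_transverse : Continuous (transverse : Rn (k + l) → Rn l) := by
  unfold transverse
  fun_prop

lemma continuous_longitudinal : Continuous (longitudinal : Rn (k + l) → Rn k) := by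
  unfold longitudinal
  fun_prop

lemma one_add_norm_le (x : Rn (k + l)) :
    1 + ‖x‖ ≤ (1 + ‖longitudinal x‖) * (1 + ‖transverse x‖) := by
  have h : ‖x‖ ≤ ‖longitudinal x‖ + ‖transverse x‖ := by
    refine abs_le_of_sq_le_sq' ?_ (by positivity) |>.2
    rw [norm_sq_eq_longitudinal_add_transverse]
    nlinarith [norm_nonneg (longitudinal x), norm_nonneg (transverse x)]
  nlinarith [norm_nonneg (longitudinal x), norm_nonneg (transverse x)]

/-- A point of the far set that moves freely, away from the surface, is at time `t` at distance
at least `r / 2 + m |t|` from it. -/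
lemma le_norm_transverse_flow {r m : ℝ} (hr : 0 ≤ r) (hm : 0 ≤ m) {z : Rn (k + l) × Rn (k + l)}
    (hz : z ∈ farSet k l r m) {t : ℝ}
    (ht : 0 ≤ t * inner ℝ (transverse z.1) (transverse z.2)) :
    r / 2 + m * |t| ≤ ‖transverse (z.1 + (2 * t) • z.2)‖ := by
  rw [transverse_add, transverse_smul]
  refine abs_le_of_sq_le_sq' ?_ (norm_nonneg _) |>.2
  rw [norm_add_sq_real, inner_smul_right, norm_smul, mul_pow, Real.norm_eq_abs, sq_abs]
  have h1 : r ^ 2 ≤ ‖transverse z.1‖ ^ 2 := pow_le_pow_left₀ hr hz.1.le 2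
  have h2 : m ^ 2 ≤ ‖transverse z.2‖ ^ 2 := pow_le_pow_left₀ hm hz.2.le 2
  have h3 : t ^ 2 * m ^ 2 ≤ t ^ 2 * ‖transverse z.2‖ ^ 2 := by gcongr
  have h4 : (m * |t|) ^ 2 = t ^ 2 * m ^ 2 := by rw [mul_pow, sq_abs]; ring
  nlinarith [sq_nonneg (r / 2 - m * |t|), sq_nonneg r]

end Geometry

section WindowProfile

variable {k l : ℕ}

lemma exists_one_add_norm_pow_mul_le {n : ℕ} (f : 𝓢(Rn n, ℂ)) (N : ℕ) :
    ∃ C : ℝ, 0 ≤ C ∧ ∀ x, (1 + ‖x‖) ^ N * ‖f x‖ ≤ C := by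
  refine ⟨2 ^ N * ((Finset.Iic (N, 0)).sup fun m => SchwartzMap.seminorm ℝ m.1 m.2) f,
    by positivity, fun x => ?_⟩
  have := SchwartzMap.one_add_le_sup_seminorm_apply (𝕜 := ℝ) (m := (N, 0)) le_rfl le_rfl f x
  simpa using this

namespace Window

variable (η : Window k l)

lemma continuous_toFun : Continuous η.toFun :=
  (η.par.continuous.comp continuous_longitudinal).mul (η.perp.continuous.comp continuous_transverse)

lemma integrable_pow_mul_toFun (n : ℕ) : Integrable fun v => ‖v‖ ^ n * ‖η.toFun v‖ := by
  obtain ⟨A, hA0, hA⟩ := exists_one_add_norm_pow_mul_le η.par (n + (k + l + 1))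
  obtain ⟨B, hB0, hB⟩ := exists_one_add_norm_pow_mul_le η.perp (n + (k + l + 1))
  have hint : Integrable fun v : Rn (k + l) => A * B * (1 + ‖v‖) ^ (-((k + l + 1 : ℕ) : ℝ)) :=
    (integrable_one_add_norm (by simp)).const_mul _
  have hc := η.continuous_toFun
  refine hint.mono' (by fun_prop) (.of_forall fun v => ?_)
  rw [Real.norm_of_nonneg (by positivity), Real.rpow_neg (by positivity), Real.rpow_natCast,
    ← div_eq_mul_inv, le_div_iff₀ (by positivity)]
  calc ‖v‖ ^ n * ‖η.toFun v‖ * (1 + ‖v‖) ^ (k + l + 1)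
      ≤ (1 + ‖v‖) ^ n * ‖η.toFun v‖ * (1 + ‖v‖) ^ (k + l + 1) := by
        gcongr; linarith
    _ = (1 + ‖v‖) ^ (n + (k + l + 1)) * ‖η.toFun v‖ := by ring
    _ ≤ ((1 + ‖longitudinal v‖) * (1 + ‖transverse v‖)) ^ (n + (k + l + 1)) * ‖η.toFun v‖ := by
        gcongr; exact one_add_norm_le v
    _ = ((1 + ‖longitudinal v‖) ^ (n + (k + l + 1)) * ‖η.par (longitudinal v)‖) *
          ((1 + ‖transverse v‖) ^ (n + (k + l + 1)) * ‖η.perp (transverse v)‖) := by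
        rw [toFun, norm_mul, mul_pow]; ring
    _ ≤ A * B := by gcongr; exacts [hA _, hB _]

variable {δ : ℝ}

lemma continuous_scaled (δ : ℝ) : Continuous (η.scaled δ) := by
  have := η.continuous_toFun
  unfold scaled
  fun_prop

lemma integrable_pow_mul_scaled (hδ : 0 < δ) (n : ℕ) :
    Integrable fun v => ‖v‖ ^ n * ‖η.scaled δ v‖ := by
  have h := ((η.integrable_pow_mul_toFun n).comp_smul hδ.ne').const_mul
    (δ ^ (((k + l : ℕ) : ℝ) / 2) * (δ ^ n)⁻¹)
  refine h.congr (.of_forall fun v => ?_)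
  simp only [scaled, norm_smul, norm_mul, Complex.norm_real, Real.norm_eq_abs, abs_of_pos hδ,
    abs_of_pos (Real.rpow_pos_of_pos hδ _), mul_pow]
  field_simp

lemma integrable_scaled (hδ : 0 < δ) : Integrable (η.scaled δ) := by
  have h := η.integrable_pow_mul_scaled hδ 0
  simp only [pow_zero, one_mul] at h
  exact (integrable_norm_iff (η.continuous_scaled δ).aestronglyMeasurable).1 h

/-- The spectral support of the rescaled window; the radius is `δ / 2π`, since Mathlib's frequency is
momentum divided by `2π`. -/
lemma fourier_scaled_eq_zero (hδ : 0 < δ) {ξ : Rn (k + l)} (hξ : δ / (2 * Real.pi) < ‖ξ‖) :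
    𝓕 (η.scaled δ) ξ = 0 := by
  have hpi := Real.pi_pos
  have h1 : 1 < ‖(2 * Real.pi / δ) • ξ‖ := by
    rw [norm_smul, Real.norm_of_nonneg (by positivity), div_mul_eq_mul_div, lt_div_iff₀ hδ, one_mul,
      mul_comm]
    rwa [div_lt_iff₀ (by positivity)] at hξ
  have h2 := η.fourier_support _ h1
  rw [angularFourier, mul_eq_zero] at h2
  have h3 : ∫ x, η.toFun x * cexp (-(I * ((inner ℝ x ((2 * Real.pi / δ) • ξ) : ℝ) : ℂ))) = 0 := by
    refine h2.resolve_left ?_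
    exact_mod_cast (Real.rpow_pos_of_pos (by positivity) _).ne'
  have h4 := Measure.integral_comp_smul (volume : Measure (Rn (k + l)))
    (fun x => η.toFun x * cexp (-(I * ((inner ℝ x ((2 * Real.pi / δ) • ξ) : ℝ) : ℂ)))) δ
  rw [h3, smul_zero] at h4
  rw [Real.fourier_eq', ← mul_zero ((δ ^ (((k + l : ℕ) : ℝ) / 2) : ℝ) : ℂ), ← h4,
    ← integral_const_mul]
  refine integral_congr_ae (.of_forall fun x => ?_)
  simp only [scaled, smul_eq_mul]
  have e : cexp (((-2 * Real.pi * inner ℝ x ξ : ℝ) : ℂ) * I) =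
      cexp (-(I * ((inner ℝ (δ • x) ((2 * Real.pi / δ) • ξ) : ℝ) : ℂ))) := by
    congr 1
    rw [inner_smul_left, inner_smul_right, RCLike.conj_to_real]
    push_cast
    have : (δ : ℂ) ≠ 0 := by exact_mod_cast hδ.ne'
    field_simp
  rw [e]
  ring

/-- The rescaled window is again a unit vector. -/
lemma lintegral_scaled_sq (hδ : 0 < δ) : ∫⁻ u, ‖η.scaled δ u‖ₑ ^ 2 = 1 := by
  have h1 : ∫ u, ‖η.scaled δ u‖ ^ 2 = 1 := by
    have h := Measure.integral_comp_smul (volume : Measure (Rn (k + l)))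
      (fun x => ‖η.toFun x‖ ^ 2) δ
    have hn : ∫ x, ‖η.toFun x‖ ^ 2 = 1 := η.norm_one
    rw [hn, finrank_euclideanSpace_fin, abs_of_pos (by positivity)] at h
    have e : ∀ u, ‖η.scaled δ u‖ ^ 2 = δ ^ (k + l) * ‖η.toFun (δ • u)‖ ^ 2 := by
      intro u
      rw [scaled, norm_mul, mul_pow, Complex.norm_real, Real.norm_eq_abs, sq_abs,
        ← Real.rpow_natCast (δ ^ _) 2, ← Real.rpow_mul hδ.le, ← Real.rpow_natCast δ (k + l)]
      congr 2
      push_cast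
      ring
    simp only [e]
    rw [integral_const_mul, h, smul_eq_mul, mul_one, mul_inv_cancel₀ (by positivity)]
  have h2 : Integrable fun u => ‖η.scaled δ u‖ ^ 2 := by
    by_contra h
    rw [integral_undef h] at h1
    exact zero_ne_one h1
  rw [← ENNReal.ofReal_one, ← h1, ofReal_integral_eq_lintegral_ofReal h2
    (.of_forall fun u => by positivity)]
  refine lintegral_congr fun u => ?_
  rw [← ofReal_norm, ENNReal.ofReal_pow (norm_nonneg _)]

/-- The Fourier transform of the rescaled window `η_δ`. -/
noncomputable def profile (hδ : 0 < δ) : Profile (k + l) (δ / (2 * Real.pi)) where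
  toFun := 𝓕 (η.scaled δ)
  smooth := Real.contDiff_fourier fun n _ => η.integrable_pow_mul_scaled hδ n
  zero_of_lt _ hξ := η.fourier_scaled_eq_zero hδ hξ

lemma wave_profile_zero (hδ : 0 < δ) : (η.profile hδ).wave 0 = η.scaled δ := by
  have hint : Integrable (𝓕 (η.scaled δ)) := by
    refine (η.profile hδ).smooth.continuous.integrable_of_hasCompactSupport
      (HasCompactSupport.of_support_subset_isCompact (isCompact_closedBall 0 (δ / (2 * Real.pi)))
        fun ξ hξ => ?_)
    by_contra h
    exact hξ ((η.profile hδ).zero_of_lt ξ (by simpa using h))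
  rw [← (η.continuous_scaled δ).fourierInv_fourier_eq (η.integrable_scaled hδ) hint]
  funext u
  rw [Real.fourierInv_eq', Profile.wave]
  refine integral_congr_ae (.of_forall fun ξ => ?_)
  simp only [zero_mul, sub_zero, smul_eq_mul, mul_comm I, profile]

lemma packet_profile (hδ : 0 < δ) (z : Rn (k + l) × Rn (k + l)) :
    ⇑((η.profile hδ).packet 0 z.1 z.2) = η.coherent δ z := by
  funext y
  simp [Profile.packet_apply, wave_profile_zero, coherent]

lemma overlap_eq_inner_state (hδ : 0 < δ) (ψ : L2 (k + l)) (z : Rn (k + l) × Rn (k + l)) :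
    η.overlap δ ψ z = ⟪(η.profile hδ).state z, ψ⟫_ℂ := by
  rw [Profile.state, Profile.inner_packet, packet_profile]
  rfl

lemma isLocalization_localization (hδ : 0 < δ) (E : Set (Rn (k + l) × Rn (k + l)))
    (ψ : L2 (k + l)) : η.IsLocalization δ E ψ ((η.profile hδ).localization E ψ) := by
  intro φ
  simp only [η.overlap_eq_inner_state hδ]
  exact ⟨(η.profile hδ).integrableOn_overlap E φ ψ, (η.profile hδ).inner_localization E φ ψ⟩

end Window

end WindowProfile

section FreeDomain

lemma dense_freeHamiltonian_domain (d : ℕ) :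
    Dense ((freeHamiltonian d).domain : Set (L2 d)) := by
  have key : ∀ f : 𝓢(Rn d, ℂ), (f.toLp 2 (volume : Measure (Rn d)) : L2 d) ∈ (freeHamiltonian d).domain := by
    intro f
    have h1 : fourierL2 d (f.toLp 2 (volume : Measure (Rn d))) = (𝓕 f).toLp 2 := SchwartzMap.toLp_fourier_eq f
    suffices fourierL2 d (f.toLp 2 (volume : Measure (Rn d))) ∈ symbolDomain d from this
    rw [h1]
    have hg : (fun ξ : Rn d => (freeSymbol ξ : ℂ)).HasTemperateGrowth := by
      simp only [freeSymbol, mul_pow]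
      fun_prop
    have h2 := (SchwartzMap.smulLeftCLM ℂ (fun ξ : Rn d => (freeSymbol ξ : ℂ)) (𝓕 f)).memLp 2
      (volume : Measure (Rn d))
    have h3 : MemLp (fun ξ => (freeSymbol ξ : ℂ) * (𝓕 f).toLp 2 volume ξ) 2 volume := by
      refine h2.ae_eq ?_
      filter_upwards [SchwartzMap.coeFn_toLp (𝓕 f) 2 (volume : Measure (Rn d))] with ξ hξ
      rw [hξ, SchwartzMap.smulLeftCLM_apply_apply hg, smul_eq_mul]
    exact h3
  have hd := SchwartzMap.denseRange_toLpCLM (E := Rn d) (F := ℂ) (p := 2)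
    (μ := (volume : Measure (Rn d))) ENNReal.ofNat_ne_top
  refine Dense.mono ?_ hd
  rintro _ ⟨f, rfl⟩
  exact key f

end FreeDomain

/-! ### Escape from the surface and the wave operators -/

section SurfaceEstimates

variable {k l : ℕ} (V : SurfacePotential k l)

namespace SurfacePotential

lemma op_adjoint : ContinuousLinearMap.adjoint V.op = V.op := by
  symm
  rw [ContinuousLinearMap.eq_adjoint_iff]
  exact mulOp_symm V.toFun V.memLp_top

lemma op_ae_eq_zero {r₀ : ℝ} (h : ∀ x, V.toFun x ≠ 0 → ‖transverse x‖ ≤ r₀) (f : L2 (k + l)) :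
    ∀ᵐ y, y ∉ {y : Rn (k + l) | ‖transverse y‖ ≤ r₀} → V.op f y = 0 := by
  filter_upwards [mulOp_coeFn _ V.memLp_top f] with y hy hyA
  have h0 : V.toFun y = 0 := by
    by_contra h1
    exact hyA (h y h1)
  rw [op, hy, h0]
  simp

lemma norm_op_le_of_lintegral {r₀ M a : ℝ} (h : ∀ x, V.toFun x ≠ 0 → ‖transverse x‖ ≤ r₀)
    (hM : ∀ x, |V.toFun x| ≤ M) (ha : 0 ≤ a) {f : L2 (k + l)}
    (hf : ∫⁻ y in {y : Rn (k + l) | ‖transverse y‖ ≤ r₀}, ‖f y‖ₑ ^ 2 ≤ ENNReal.ofReal (a ^ 2)) :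
    ‖V.op f‖ ≤ M * a := by
  have hM0 : 0 ≤ M := (abs_nonneg _).trans (hM 0)
  refine abs_le_of_sq_le_sq' ?_ (by positivity) |>.2
  rw [← ENNReal.ofReal_le_ofReal_iff (by positivity), ← lintegral_enorm_sq_eq, mul_pow,
    ENNReal.ofReal_mul (by positivity)]
  have hA : MeasurableSet {y : Rn (k + l) | ‖transverse y‖ ≤ r₀} :=
    measurableSet_le continuous_transverse.norm.measurable measurable_const
  refine le_trans ?_ (mul_le_mul_right hf _)
  rw [← lintegral_indicator hA, ← lintegral_const_mul' _ _ ENNReal.ofReal_ne_top]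
  refine lintegral_mono_ae ?_
  filter_upwards [mulOp_coeFn _ V.memLp_top f] with y hy
  rw [op, hy, enorm_mul, mul_pow]
  by_cases hyA : y ∈ {y : Rn (k + l) | ‖transverse y‖ ≤ r₀}
  · rw [Set.indicator_of_mem hyA]
    refine mul_le_mul_left ?_ _
    rw [← ofReal_norm, ← ENNReal.ofReal_pow (norm_nonneg _), Complex.norm_real]
    exact ENNReal.ofReal_le_ofReal (pow_le_pow_left₀ (norm_nonneg _) (hM y) 2)
  · have h0 : V.toFun y = 0 := by
      by_contra h1
      exact hyA (h y h1)
    simp [h0]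

end SurfacePotential

variable {m δ : ℝ}

/-- The escape estimate: a vector living within `r` of the surface, evolved back by the free
dynamics, has little weight on a far set that the classical flow carries away from the surface. -/
lemma Profile.exists_norm_localization_le (hm : 0 < m) (hδ : 0 < δ) (hδm : δ < m / 8)
    (s : Profile (k + l) (δ / (2 * Real.pi))) (hs : ∫⁻ u, ‖s.wave 0 u‖ₑ ^ 2 = 1) :
    ∃ C : ℝ, 0 ≤ C ∧ ∀ (r n t : ℝ), 4 ≤ n → 4 * r ≤ n →
      ∀ E : Set (Rn (k + l) × Rn (k + l)), E ⊆ farSet k l n m →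
        (∀ z ∈ E, 0 ≤ t * inner ℝ (transverse z.1) (transverse z.2)) →
          ∀ f : L2 (k + l), (∀ᵐ y, y ∉ {y : Rn (k + l) | ‖transverse y‖ ≤ r} → f y = 0) →
            ‖s.localization E (freePropagator (k + l) (-t) f)‖ ≤
              C * ((n / 4 + m / 2 * |t|) ^ 2)⁻¹ * ‖f‖ := by
  have hpi := Real.pi_pos
  obtain ⟨C, hC, h⟩ := s.exists_lintegral_wave_le (by positivity)
  refine ⟨C, hC, fun r n t hn hr E hE hEt f hf => ?_⟩
  have hmt : 0 ≤ m * |t| := by positivity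
  have hS : MeasurableSet {v : Rn (k + l) | n / 2 + m * |t| ≤ ‖transverse v‖} :=
    measurableSet_le measurable_const continuous_transverse.norm.measurable
  refine s.norm_localization_freePropagator_le hs hS
    (fun z hz => le_norm_transverse_flow (by linarith) hm.le (hE hz) (hEt z hz)) hf
    (ρ := n / 4 + m / 2 * |t|) (fun y hy v hv => ?_) (by positivity)
    (h t (n / 4 + m / 2 * |t|) (by nlinarith) ?_)
  · simp only [Set.mem_ofPred_eq] at hy hv
    have h1 := norm_transverse_le (y - v)
    rw [transverse_sub] at h1
    have h2 := norm_sub_norm_le (transverse v) (transverse y)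
    rw [norm_sub_rev] at h2
    linarith
  -- The spreading speed `4δ` stays below half the escape speed `m`: this is where `δ < m / 8` enters.
  · have h1 : 8 * Real.pi * (δ / (2 * Real.pi)) * |t| = 4 * δ * |t| := by
      field_simp
      ring
    have h2 : δ * |t| ≤ m / 8 * |t| := by gcongr
    rw [h1]
    linarith

/-- The escape estimate in the form that Cook's method needs, obtained by taking adjoints. -/
lemma norm_op_freePropagator_localization_le {κ : ℝ} (s : Profile (k + l) κ)
    (E : Set (Rn (k + l) × Rn (k + l))) {t a : ℝ}
    (h : ∀ f, ‖s.localization E (freePropagator (k + l) (-t) (V.op f))‖ ≤ a * ‖V.op f‖) (ha : 0 ≤ a)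
    (ψ : L2 (k + l)) :
    ‖V.op (freePropagator (k + l) t (s.localization E ψ))‖ ≤ ‖V.op‖ * a * ‖ψ‖ := by
  let B := V.op ∘L freePropagator (k + l) t ∘L s.localization E
  have hadj : ContinuousLinearMap.adjoint B =
      s.localization E ∘L freePropagator (k + l) (-t) ∘L V.op := by
    simp only [B, ContinuousLinearMap.adjoint_comp, V.op_adjoint, s.localization_adjoint,
      (freePropagator_isPropagator (n := k + l)).toIsUnitaryGroup.adjoint_eq]
    rfl
  have hB : ‖B‖ ≤ ‖V.op‖ * a := by
    rw [← ContinuousLinearMap.adjoint.norm_map, hadj]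
    refine ContinuousLinearMap.opNorm_le_bound _ (by positivity) fun f => ?_
    refine (h f).trans ?_
    calc a * ‖V.op f‖ ≤ a * (‖V.op‖ * ‖f‖) := by gcongr; exact V.op.le_opNorm f
      _ = ‖V.op‖ * a * ‖f‖ := by ring
  exact B.le_of_opNorm_le hB ψ

lemma exists_approx_transverse_bounded (f : L2 (k + l)) {ε : ℝ} (hε : 0 < ε) :
    ∃ (r : ℝ) (g : L2 (k + l)), ‖f - g‖ ≤ ε ∧
      ∀ᵐ y, y ∉ {y : Rn (k + l) | ‖transverse y‖ ≤ r} → g y = 0 := by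
  obtain ⟨g, hgc, hg, -, hgm⟩ := (Lp.memLp f).exists_hasCompactSupport_eLpNorm_sub_le
    ENNReal.ofNat_ne_top (ε := ENNReal.ofReal ε) (by simpa using hε)
  obtain ⟨r, hr⟩ := hgc.isCompact.isBounded.subset_closedBall 0
  refine ⟨r, hgm.toLp g, ?_, ?_⟩
  · rw [← ENNReal.ofReal_le_ofReal_iff hε.le, ofReal_norm, Lp.enorm_def]
    refine le_trans (le_of_eq (eLpNorm_congr_ae ?_)) hg
    filter_upwards [Lp.coeFn_sub f (hgm.toLp g), hgm.coeFn_toLp] with y h1 h2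
    rw [h1, Pi.sub_apply, Pi.sub_apply, h2]
  · filter_upwards [hgm.coeFn_toLp] with y hy hyr
    rw [hy]
    by_contra h0
    refine hyr ((norm_transverse_le y).trans ?_)
    simpa using hr (subset_tsupport g h0)

end SurfaceEstimates

section WaveOperators

variable {k l : ℕ} (V : SurfacePotential k l)

/-- Packets whose transverse momenta stay away from zero leave the surface fast enough for Cook's
method, in both time directions. -/
lemma exists_norm_op_packet_le {κ : ℝ} (hκ : 0 < κ) (s : Profile (k + l) κ) {p : Rn (k + l)}
    (hp : 8 * Real.pi * κ ≤ ‖transverse p‖) :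
    ∃ K T : ℝ, 0 ≤ K ∧ 0 < T ∧ ∀ t : ℝ, T ≤ |t| →
      ‖V.op (freePropagator (k + l) t ((s.packet 0 0 p).toLp 2))‖ ≤ K * (|t| ^ 2)⁻¹ := by
  obtain ⟨M, hM⟩ := V.bounded
  obtain ⟨r₀, hr₀, hr⟩ := V.supported
  obtain ⟨C, hC, h⟩ := s.exists_lintegral_wave_le hκ
  have hpi := Real.pi_pos
  have hP : 0 < ‖transverse p‖ := lt_of_lt_of_le (by positivity) hp
  have hM0 : 0 ≤ M := (abs_nonneg _).trans (hM 0)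
  refine ⟨M * C * (‖transverse p‖ ^ 2)⁻¹, (r₀ + 1) / ‖transverse p‖, by positivity, by positivity,
    fun t ht => ?_⟩
  rw [div_le_iff₀ hP] at ht
  rw [Profile.freePropagator_packet, zero_add]
  have e : M * C * (‖transverse p‖ ^ 2)⁻¹ * (|t| ^ 2)⁻¹ =
      M * (C * ((|t| * ‖transverse p‖) ^ 2)⁻¹) := by
    rw [mul_pow, mul_inv]
    ring
  rw [e]
  refine V.norm_op_le_of_lintegral hr hM (by positivity) ?_
  refine le_trans ?_ (h t (|t| * ‖transverse p‖) (by linarith) ?_)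
  · have hA : MeasurableSet {y : Rn (k + l) | ‖transverse y‖ ≤ r₀} :=
      measurableSet_le continuous_transverse.norm.measurable measurable_const
    have hB : MeasurableSet {u : Rn (k + l) | |t| * ‖transverse p‖ ≤ ‖u‖} :=
      measurableSet_le measurable_const measurable_norm
    rw [← lintegral_indicator hA, ← lintegral_indicator hB, ← lintegral_sub_right_eq_self
      ({u : Rn (k + l) | |t| * ‖transverse p‖ ≤ ‖u‖}.indicator fun u => ‖s.wave t u‖ₑ ^ 2)
      ((2 * t) • p)]
    refine lintegral_mono_ae ?_
    filter_upwards [SchwartzMap.coeFn_toLp (s.packet t 0 p) 2] with y hy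
    by_cases hyA : y ∈ {y : Rn (k + l) | ‖transverse y‖ ≤ r₀}
    · have h1 : y - (2 * t) • p ∈ {u : Rn (k + l) | |t| * ‖transverse p‖ ≤ ‖u‖} := by
        have h2 := norm_transverse_le (y - (2 * t) • p)
        rw [transverse_sub, transverse_smul] at h2
        have h3 := norm_sub_norm_le ((2 * t) • transverse p) (transverse y)
        rw [norm_sub_rev, norm_smul, Real.norm_eq_abs, abs_mul, abs_two] at h3
        have h4 : ‖transverse y‖ ≤ r₀ := hyA
        simp only [Set.mem_ofPred_eq]
        nlinarith
      rw [Set.indicator_of_mem hyA, Set.indicator_of_mem h1, hy, Profile.packet_apply, zero_add,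
        enorm_mul, ← ofReal_norm (cexp _), mul_comm I, Complex.norm_exp_ofReal_mul_I,
        ENNReal.ofReal_one, one_mul]
    · rw [Set.indicator_of_notMem hyA]
      exact zero_le
  · rw [mul_comm |t|]
    gcongr

lemma volume_transverse_eq_zero (hl : 1 ≤ l) :
    volume {ξ : Rn (k + l) | transverse ξ = 0} = 0 := by
  let L : Submodule ℝ (Rn (k + l)) :=
    { carrier := {ξ | transverse ξ = 0}
      add_mem' := fun {a b} ha hb => by
        simp only [Set.mem_ofPred_eq] at ha hb ⊢
        rw [transverse_add, ha, hb, add_zero]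
      zero_mem' := rfl
      smul_mem' := fun c a ha => by
        simp only [Set.mem_ofPred_eq] at ha ⊢
        rw [transverse_smul, ha, smul_zero] }
  have hL : L ≠ ⊤ := by
    intro h
    let v : Rn (k + l) := WithLp.toLp 2 fun _ => 1
    have h1 : transverse v = 0 := (h ▸ Submodule.mem_top : v ∈ L)
    have h2 := congrArg (fun w : Rn l => w ⟨0, hl⟩) h1
    simp [transverse, v] at h2
  exact Measure.addHaar_submodule volume L hL

/-- Packets whose transverse momenta stay away from zero are total. -/
lemma eq_zero_of_inner_packet_eq_zero (hl : 1 ≤ l) {φ : L2 (k + l)}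
    (h : ∀ (κ : ℝ) (s : Profile (k + l) κ) (p : Rn (k + l)), 0 < κ →
      8 * Real.pi * κ ≤ ‖transverse p‖ → ⟪(s.packet 0 0 p).toLp 2, φ⟫_ℂ = 0) : φ = 0 := by
  set F := fourierL2 (k + l) φ with hF
  have hpi := Real.pi_pos
  have hloc : ∀ ξ₀ : Rn (k + l), transverse ξ₀ ≠ 0 →
      ∀ᵐ ξ, ξ ∈ Metric.ball ξ₀ (‖transverse ξ₀‖ / 4) → F ξ = 0 := by
    intro ξ₀ hξ₀
    -- A packet with momentum `2πξ₀` and this `κ` satisfies `8πκ = ‖2π ξ₀^⊥‖`.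
    set κ := ‖transverse ξ₀‖ / 4 with hκ
    have hκ0 : 0 < κ := by have := norm_pos_iff.2 hξ₀; positivity
    have hFl : LocallyIntegrable F := (Lp.memLp F).locallyIntegrable (by norm_num)
    refine Metric.isOpen_ball.ae_eq_zero_of_integral_contDiff_smul_eq_zero
      (hFl.locallyIntegrableOn _) fun g hg hgc hgs => ?_
    let s : Profile (k + l) κ :=
      { toFun := fun ζ => (g (ζ + ξ₀) : ℂ)
        smooth := Complex.ofRealCLM.contDiff.comp (hg.comp (contDiff_id.add contDiff_const))
        zero_of_lt := fun ζ hζ => by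
          have : ζ + ξ₀ ∉ tsupport g := fun hm => by
            have := hgs hm
            rw [Metric.mem_ball, dist_eq_norm, add_sub_cancel_right] at this
            linarith
          rw [image_eq_zero_of_notMem_tsupport this, Complex.ofReal_zero] }
    have h0 := h κ s ((2 * Real.pi) • ξ₀) hκ0 (by
      rw [transverse_smul, norm_smul, Real.norm_of_nonneg (by positivity), hκ]
      linarith)
    have h1 : fourierL2 (k + l) ((s.packet 0 0 ((2 * Real.pi) • ξ₀)).toLp 2) =
        ((s.symbol_hasCompactSupport 0 0 ((2 * Real.pi) • ξ₀)).toSchwartzMap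
          (s.symbol_contDiff 0 0 ((2 * Real.pi) • ξ₀))).toLp 2 := by
      refine (SchwartzMap.toLp_fourier_eq (s.packet 0 0 ((2 * Real.pi) • ξ₀))).trans ?_
      rw [Profile.packet, FourierTransform.fourier_fourierInv_eq]
    rw [← (fourierL2 (k + l)).inner_map_map, h1, ← hF, L2.inner_def] at h0
    rw [← h0]
    refine integral_congr_ae ?_
    filter_upwards [SchwartzMap.coeFn_toLp ((s.symbol_hasCompactSupport 0 0
      ((2 * Real.pi) • ξ₀)).toSchwartzMap (s.symbol_contDiff 0 0 ((2 * Real.pi) • ξ₀))) 2] with ξ hξ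
    rw [hξ, RCLike.inner_apply, HasCompactSupport.toSchwartzMap_toFun, Profile.symbol]
    have hpi2 : (2 * Real.pi) ≠ 0 := by positivity
    have e : ξ - (2 * Real.pi)⁻¹ • (2 * Real.pi) • ξ₀ + ξ₀ = ξ := by
      rw [smul_smul, inv_mul_cancel₀ hpi2, one_smul, sub_add_cancel]
    have e' : s.toFun (ξ - (2 * Real.pi)⁻¹ • (2 * Real.pi) • ξ₀) = (g ξ : ℂ) := by
      simp only [s, e]
    rw [e']
    simp [mul_comm]
  have hnull : volume {ξ : Rn (k + l) | transverse ξ ≠ 0 ∧ F ξ ≠ 0} = 0 := by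
    refine measure_null_of_locally_null _ fun ξ₀ hξ₀ => ?_
    refine ⟨{ξ | ¬ (ξ ∈ Metric.ball ξ₀ (‖transverse ξ₀‖ / 4) → F ξ = 0)}, ?_,
      ae_iff.1 (hloc ξ₀ hξ₀.1)⟩
    have hpos : 0 < ‖transverse ξ₀‖ / 4 := by have := norm_pos_iff.2 hξ₀.1; positivity
    filter_upwards [self_mem_nhdsWithin,
      mem_nhdsWithin_of_mem_nhds (Metric.ball_mem_nhds ξ₀ hpos)] with ξ h1 h2
    simp only [not_forall]
    exact ⟨h2, h1.2⟩
  have hF0 : F = 0 := by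
    refine Lp.ext ?_
    have h1 : ∀ᵐ ξ : Rn (k + l), ¬ (transverse ξ = 0) := by
      rw [ae_iff]
      simpa using volume_transverse_eq_zero (k := k) hl
    have h2 : ∀ᵐ ξ : Rn (k + l), ¬ (transverse ξ ≠ 0 ∧ F ξ ≠ 0) := by
      rw [ae_iff]
      simpa using hnull
    filter_upwards [h1, h2, Lp.coeFn_zero ℂ 2 (volume : Measure (Rn (k + l)))] with ξ a b c
    rw [c]
    by_contra hne
    exact b ⟨a, hne⟩
  exact (fourierL2 (k + l)).map_eq_zero_iff.1 hF0

/-- Existence of the wave operators; `σ = 1` is the limit `t → ∞` and `σ = -1` the limit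
`t → -∞`. -/
lemma exists_waveOperator (hl : 1 ≤ l) {σ : ℝ} (hσ : σ = 1 ∨ σ = -1) :
    ∃ Ω : L2 (k + l) →L[ℂ] L2 (k + l), ∀ ψ, Tendsto
      (fun t : ℝ => V.propagator (-(σ * t)) (freePropagator (k + l) (σ * t) ψ)) atTop
        (𝓝 (Ω ψ)) := by
  have hG := freePropagator_isPropagator (n := k + l)
  have hU : IsPropagator ((V.op : L2 (k + l) →ₗ[ℂ] L2 (k + l)) +ᵥ freeHamiltonian (k + l))
      V.propagator := V.isPropagator_propagator
  have hσ1 : |σ| = 1 := by rcases hσ with rfl | rfl <;> simp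
  refine exists_strong_limit
    (W := fun t => V.propagator (-(σ * t)) ∘L freePropagator (k + l) (σ * t))
    (fun t x => by simp [hU.norm_map, hG.norm_map]) fun φ hφ => ?_
  refine eq_zero_of_inner_packet_eq_zero hl fun κ s p hκ hp => hφ _ ?_
  obtain ⟨K, T, hK, hT, hdec⟩ := exists_norm_op_packet_le V hκ s hp
  have hdec' : ∀ r, T ≤ r → ‖V.op (freePropagator (k + l) (σ * r) ((s.packet 0 0 p).toLp 2))‖ ≤
      K * (r ^ 2)⁻¹ := by
    intro r hr
    have h1 : |σ * r| = r := by rw [abs_mul, hσ1, one_mul, abs_of_pos (hT.trans_le hr)]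
    have h2 := hdec (σ * r) (by rw [h1]; exact hr)
    rwa [h1] at h2
  exact hG.cauchySeq_interaction hU (dense_freeHamiltonian_domain (k + l)) hσ hK hT hdec'

/-- The intertwining relation, passed to the adjoint. -/
lemma adjoint_waveOperator_propagator {σ : ℝ} (hσ : σ = 1 ∨ σ = -1)
    {Ω : L2 (k + l) →L[ℂ] L2 (k + l)} (hΩ : ∀ ψ, Tendsto
      (fun t : ℝ => V.propagator (-(σ * t)) (freePropagator (k + l) (σ * t) ψ)) atTop (𝓝 (Ω ψ)))
    (t : ℝ) (φ : L2 (k + l)) : ContinuousLinearMap.adjoint Ω (V.propagator t φ) =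
      freePropagator (k + l) t (ContinuousLinearMap.adjoint Ω φ) := by
  have hG := freePropagator_isPropagator (n := k + l)
  have hU := V.isPropagator_propagator
  have hσ2 : σ * σ = 1 := by rcases hσ with rfl | rfl <;> norm_num
  have hint : ∀ t ψ, Ω (freePropagator (k + l) t ψ) = V.propagator t (Ω ψ) := by
    intro t ψ
    refine tendsto_nhds_unique (hΩ _) ?_
    have h1 := ((V.propagator t).continuous.tendsto _).comp
      ((hΩ ψ).comp (tendsto_atTop_add_const_right atTop (σ * t) tendsto_id))
    refine h1.congr fun r => ?_
    have e1 : σ * (r + σ * t) = σ * r + t := by rw [mul_add, ← mul_assoc, hσ2, one_mul]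
    have e2 : t + -(σ * r + t) = -(σ * r) := by ring
    simp only [Function.comp, id_eq, e1]
    rw [← hU.add, e2, hG.add]
  refine ext_inner_left ℂ fun x => ?_
  calc ⟪x, ContinuousLinearMap.adjoint Ω (V.propagator t φ)⟫_ℂ
      = ⟪Ω x, V.propagator t φ⟫_ℂ := ContinuousLinearMap.adjoint_inner_right Ω x _
    _ = ⟪V.propagator (-t) (Ω x), φ⟫_ℂ := (hU.inner_neg_left t _ _).symm
    _ = ⟪Ω (freePropagator (k + l) (-t) x), φ⟫_ℂ := by rw [hint]
    _ = ⟪freePropagator (k + l) (-t) x, ContinuousLinearMap.adjoint Ω φ⟫_ℂ :=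
        (ContinuousLinearMap.adjoint_inner_right Ω _ _).symm
    _ = _ := hG.inner_neg_left t _ _

end WaveOperators

/-! ### The Enss decomposition -/

section Adjoint

variable {X : Type*} [NormedAddCommGroup X] [InnerProductSpace ℂ X] [CompleteSpace X]

/-- If `(Ω - 1) P` is small and `P` is self-adjoint, then `P` and `P Ω*` are close, since
`P (1 - Ω*)` is the adjoint of `(1 - Ω) P`. -/
lemma norm_apply_le_add_norm_apply_adjoint {P Ω : X →L[ℂ] X}
    (hP : ContinuousLinearMap.adjoint P = P) {a : ℝ} (ha : 0 ≤ a)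
    (h : ∀ ψ, ‖Ω (P ψ) - P ψ‖ ≤ a * ‖ψ‖) (φ : X) :
    ‖P φ‖ ≤ a * ‖φ‖ + ‖P (ContinuousLinearMap.adjoint Ω φ)‖ := by
  have h1 : ‖(Ω - ContinuousLinearMap.id ℂ X) ∘L P‖ ≤ a :=
    ContinuousLinearMap.opNorm_le_bound _ ha h
  rw [← ContinuousLinearMap.adjoint.norm_map, ContinuousLinearMap.adjoint_comp, map_sub,
    ContinuousLinearMap.adjoint_id, hP] at h1
  have h2 := ContinuousLinearMap.le_of_opNorm_le _ h1 φ
  have h3 : P φ = P (ContinuousLinearMap.adjoint Ω φ) -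
      (P ∘L (ContinuousLinearMap.adjoint Ω - ContinuousLinearMap.id ℂ X)) φ := by
    simp
  rw [h3]
  refine (norm_sub_le _ _).trans ?_
  linarith

end Adjoint

section Enss

variable {k l : ℕ}

/-- The part of the far set that moves away from the surface under the free classical flow. -/
def outgoingSet (k l : ℕ) (r m : ℝ) : Set (Rn (k + l) × Rn (k + l)) :=
  farSet k l r m ∩ {z | 0 ≤ inner ℝ (transverse z.1) (transverse z.2)}

/-- The part of the far set that moves towards the surface under the free classical flow. -/
def incomingSet (k l : ℕ) (r m : ℝ) : Set (Rn (k + l) × Rn (k + l)) :=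
  farSet k l r m ∩ {z | inner ℝ (transverse z.1) (transverse z.2) < 0}

lemma measurableSet_farSet (r m : ℝ) : MeasurableSet (farSet k l r m) :=
  (measurableSet_lt measurable_const
    (continuous_transverse.comp continuous_fst).norm.measurable).inter
    (measurableSet_lt measurable_const (continuous_transverse.comp continuous_snd).norm.measurable)

lemma measurableSet_incomingSet (r m : ℝ) : MeasurableSet (incomingSet k l r m) :=
  (measurableSet_farSet r m).inter (measurableSet_lt
    ((continuous_transverse.comp continuous_fst).inner
      (continuous_transverse.comp continuous_snd)).measurable measurable_const)

lemma disjoint_outgoingSet_incomingSet (r m : ℝ) :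
    Disjoint (outgoingSet k l r m) (incomingSet k l r m) := by
  refine Set.disjoint_left.2 fun z h1 h2 => ?_
  have h3 : 0 ≤ inner ℝ (transverse z.1) (transverse z.2) := h1.2
  have h4 : inner ℝ (transverse z.1) (transverse z.2) < 0 := h2.2
  linarith

lemma outgoingSet_union_incomingSet (r m : ℝ) :
    outgoingSet k l r m ∪ incomingSet k l r m = farSet k l r m := by
  ext z
  constructor
  · rintro (h | h)
    exacts [h.1, h.1]
  · intro h
    rcases le_or_gt 0 (inner ℝ (transverse z.1) (transverse z.2)) with h1 | h1
    exacts [Or.inl ⟨h, h1⟩, Or.inr ⟨h, h1⟩]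

variable (V : SurfacePotential k l) {m δ : ℝ}

set_option maxHeartbeats 400000 in
/-- On a far set whose points leave the surface in the time direction `σ`, the wave operator of
that time direction is close to the identity, in norm. -/
lemma exists_norm_waveOperator_sub_le (hm : 0 < m) (hδ : 0 < δ) (hδm : δ < m / 8)
    (s : Profile (k + l) (δ / (2 * Real.pi))) (hs : ∫⁻ u, ‖s.wave 0 u‖ₑ ^ 2 = 1) {σ : ℝ}
    (hσ : σ = 1 ∨ σ = -1) {Ω : L2 (k + l) →L[ℂ] L2 (k + l)} (hΩ : ∀ ψ, Tendsto
      (fun t : ℝ => V.propagator (-(σ * t)) (freePropagator (k + l) (σ * t) ψ)) atTop (𝓝 (Ω ψ))) :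
    ∃ K N : ℝ, 0 ≤ K ∧ ∀ n : ℝ, N ≤ n → ∀ E : Set (Rn (k + l) × Rn (k + l)),
      E ⊆ farSet k l n m → (∀ z ∈ E, 0 ≤ σ * inner ℝ (transverse z.1) (transverse z.2)) →
        ∀ ψ, ‖Ω (s.localization E ψ) - s.localization E ψ‖ ≤ K * n⁻¹ * ‖ψ‖ := by
  obtain ⟨r₀, hr₀, hr⟩ := V.supported
  obtain ⟨C, hC, h⟩ := Profile.exists_norm_localization_le hm hδ hδm s hs
  have hG := freePropagator_isPropagator (n := k + l)
  have hU : IsPropagator ((V.op : L2 (k + l) →ₗ[ℂ] L2 (k + l)) +ᵥ freeHamiltonian (k + l))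
      V.propagator := V.isPropagator_propagator
  have hσ1 : |σ| = 1 := by rcases hσ with rfl | rfl <;> simp
  refine ⟨‖V.op‖ * C * (8 / m), max 4 (4 * r₀), by positivity, fun n hn E hE hEσ ψ => ?_⟩
  have hn4 : 4 ≤ n := (le_max_left _ _).trans hn
  have hn0 : 0 < n := by linarith
  have hdec : ∀ r, 0 ≤ r → ‖V.op (freePropagator (k + l) (σ * r) (s.localization E ψ))‖ ≤
      (‖V.op‖ * C * ((m / 2) ^ 2)⁻¹ * ‖ψ‖) * ((n / (2 * m) + r) ^ 2)⁻¹ := by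
    intro r hr0
    have habs : |σ * r| = r := by rw [abs_mul, hσ1, one_mul, abs_of_nonneg hr0]
    refine (norm_op_freePropagator_localization_le V s E (t := σ * r)
      (a := C * ((n / 4 + m / 2 * r) ^ 2)⁻¹) (fun f => ?_) (by positivity) ψ).trans (le_of_eq ?_)
    · have h1 := h r₀ n (σ * r) hn4 ((le_max_right _ _).trans hn) E hE (fun z hz => by
        rw [mul_right_comm]
        exact mul_nonneg (hEσ z hz) hr0) (V.op f) (V.op_ae_eq_zero hr f)
      rwa [habs] at h1
    · have e : n / 4 + m / 2 * r = m / 2 * (n / (2 * m) + r) := by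
        field_simp
        ring
      rw [e, mul_pow (m / 2), mul_inv]
      ring
  refine (hG.norm_limit_sub_le hU (dense_freeHamiltonian_domain (k + l)) hσ (by positivity)
    (by positivity) hdec (hΩ _)).trans (le_of_eq ?_)
  field_simp
  ring

set_option maxHeartbeats 400000 in
/-- Freely evolved to the future, a fixed state has little weight on incoming far sets: their
points come from even farther away. -/
lemma tendsto_norm_localization_incoming (hm : 0 < m) (hδ : 0 < δ) (hδm : δ < m / 8)
    (s : Profile (k + l) (δ / (2 * Real.pi))) (hs : ∫⁻ u, ‖s.wave 0 u‖ₑ ^ 2 = 1)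
    {t : ℕ → ℝ} (ht : ∀ n, 0 ≤ t n) (χ : L2 (k + l)) :
    Tendsto (fun n : ℕ =>
      ‖s.localization (incomingSet k l n m) (freePropagator (k + l) (t n) χ)‖) atTop (𝓝 0) := by
  obtain ⟨C, hC, h⟩ := Profile.exists_norm_localization_le hm hδ hδm s hs
  have hG := freePropagator_isPropagator (n := k + l)
  rw [Metric.tendsto_atTop]
  intro ε hε
  obtain ⟨r, g, hg, hgr⟩ := exists_approx_transverse_bounded χ (half_pos hε)
  refine ⟨⌈max (max 4 (4 * r)) (16 * (C * ‖g‖) / ε * 2 + 1)⌉₊, fun n hn => ?_⟩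
  have hn' := Nat.ceil_le.1 hn
  have hn4 : (4 : ℝ) ≤ n := (le_max_left _ _).trans ((le_max_left _ _).trans hn')
  have hnr : 4 * r ≤ n := (le_max_right _ _).trans ((le_max_left _ _).trans hn')
  have hnC : 16 * (C * ‖g‖) / ε * 2 + 1 ≤ n := (le_max_right _ _).trans hn'
  rw [Real.dist_eq, sub_zero, abs_norm]
  set P := s.localization (incomingSet k l n m)
  have h1 : ‖P (freePropagator (k + l) (t n) (χ - g))‖ ≤ ε / 2 := by
    have h3 := s.norm_localization_le (incomingSet k l n m) hs
      (freePropagator (k + l) (t n) (χ - g))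
    rw [hG.norm_map] at h3
    exact h3.trans hg
  have h2 : ‖P (freePropagator (k + l) (t n) g)‖ < ε / 2 := by
    have h3 := h r n (-t n) hn4 hnr (incomingSet k l n m) Set.inter_subset_left (fun z hz => by
      have h4 : inner ℝ (transverse z.1) (transverse z.2) < 0 := hz.2
      nlinarith [ht n]) g hgr
    rw [neg_neg, abs_neg] at h3
    refine h3.trans_lt ?_
    have h5 : ((n / 4 + m / 2 * |t n|) ^ 2)⁻¹ ≤ 16 * (n : ℝ)⁻¹ := by
      have h6 : 0 ≤ m / 2 * |t n| := by positivity
      rw [← div_eq_mul_inv, inv_le_comm₀ (by positivity) (by positivity), inv_div]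
      nlinarith
    calc C * ((n / 4 + m / 2 * |t n|) ^ 2)⁻¹ * ‖g‖ ≤ C * (16 * (n : ℝ)⁻¹) * ‖g‖ := by gcongr
      _ = 16 * (C * ‖g‖) / n := by ring
      _ < ε / 2 := by
        have h7 : 16 * (C * ‖g‖) / ε < n / 2 := by linarith
        rw [div_lt_iff₀ hε] at h7
        rw [div_lt_iff₀ (by linarith)]
        linarith
  have h8 : freePropagator (k + l) (t n) χ = freePropagator (k + l) (t n) (χ - g) +
      freePropagator (k + l) (t n) g := by
    rw [map_sub, sub_add_cancel]
  rw [h8, P.map_add]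
  refine (norm_add_le _ _).trans_lt ?_
  linarith

end Enss

end EnssSurface

set_option maxHeartbeats 400000 in
theorem theorem4p1 (m : ℝ) (hm : 0 < m) :
    ∃ δ₀ : ℝ, 0 < δ₀ ∧
      ∀ (k l : ℕ), 1 ≤ k → 1 ≤ l → ∀ V : SurfacePotential k l,
        ∃ Ωminus Ωplus : L2 (k + l) →L[ℂ] L2 (k + l),
          V.IsWaveOperator atTop Ωminus ∧ V.IsWaveOperator atBot Ωplus ∧
          ∀ (η : Window k l) (φ : ℕ → L2 (k + l)), (∀ n, ‖φ n‖ = 1) →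
            ∀ δ : ℝ, 0 < δ → δ < δ₀ →
              ∃ φout φin φsur : ℕ → L2 (k + l),
                (∀ n, φ n = φout n + φin n + φsur n) ∧
                Tendsto (fun n => ‖Ωminus (φout n) - φout n‖) atTop (𝓝 0) ∧
                Tendsto (fun n => ‖Ωplus (φin n) - φin n‖) atTop (𝓝 0) ∧
                (∀ n : ℕ, η.IsLocalization δ (surfaceSet k l n m) (φ n) (φsur n)) ∧
                (∀ n : ℕ, η.IsLocalization δ (farSet k l n m) (φ n) (φout n + φin n)) ∧
                (∀ (φ₀ : L2 (k + l)) (t : ℕ → ℝ), (∀ n, 0 ≤ t n) →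
                  (∀ n, φ n = V.propagator (t n) φ₀) →
                    Tendsto (fun n => ‖φin n‖) atTop (𝓝 0)) := by
  refine ⟨m / 8, by positivity, fun k l _ hl V => ?_⟩
  obtain ⟨Ωm, hΩm⟩ := exists_waveOperator V hl (Or.inl rfl)
  obtain ⟨Ωp, hΩp⟩ := exists_waveOperator V hl (Or.inr rfl)
  refine ⟨Ωm, Ωp, fun ψ => by simpa using hΩm ψ, fun ψ => ?_, fun η φ hφ δ hδ hδm => ?_⟩
  · refine ((hΩp ψ).comp tendsto_neg_atBot_atTop).congr fun t => ?_
    simp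
  set s := η.profile hδ with hs_def
  have hs : ∫⁻ u, ‖s.wave 0 u‖ₑ ^ 2 = 1 := by
    rw [hs_def, η.wave_profile_zero hδ]
    exact η.lintegral_scaled_sq hδ
  obtain ⟨Km, Nm, hKm, hm'⟩ :=
    exists_norm_waveOperator_sub_le V hm hδ hδm s hs (Or.inl rfl) hΩm
  obtain ⟨Kp, Np, hKp, hp'⟩ :=
    exists_norm_waveOperator_sub_le V hm hδ hδm s hs (Or.inr rfl) hΩp
  have hlim : ∀ K : ℝ, Tendsto (fun n : ℕ => K * (n : ℝ)⁻¹) atTop (𝓝 0) := fun K => by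
    simpa using (tendsto_inv_atTop_nhds_zero_nat (𝕜 := ℝ)).const_mul K
  have hfar : ∀ n : ℕ, s.localization (farSet k l n m) (φ n) =
      s.localization (outgoingSet k l n m) (φ n) + s.localization (incomingSet k l n m) (φ n) := by
    intro n
    rw [← s.localization_union (disjoint_outgoingSet_incomingSet _ _)
      (measurableSet_incomingSet _ _), outgoingSet_union_incomingSet]
  have hin : ∀ (n : ℕ) (z) (_ : z ∈ incomingSet k l n m),
      0 ≤ (-1 : ℝ) * inner ℝ (transverse z.1) (transverse z.2) := fun n z hz => by
    have : inner ℝ (transverse z.1) (transverse z.2) < 0 := hz.2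
    linarith
  refine ⟨fun n => s.localization (outgoingSet k l n m) (φ n),
    fun n => s.localization (incomingSet k l n m) (φ n),
    fun n => s.localization (surfaceSet k l n m) (φ n), fun n => ?_, ?_, ?_, fun n => ?_,
    fun n => ?_, fun φ₀ t ht hφt => ?_⟩
  · rw [← hfar]
    exact (s.localization_add_compl hs (measurableSet_farSet _ _) (φ n)).symm
  · refine squeeze_zero' (.of_forall fun n => norm_nonneg _) ?_ (hlim Km)
    filter_upwards [eventually_ge_atTop ⌈Nm⌉₊] with n hn
    have h := hm' n (Nat.ceil_le.1 hn) (outgoingSet k l n m) Set.inter_subset_left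
      (fun z hz => by rw [one_mul]; exact hz.2) (φ n)
    exact h.trans_eq (by rw [hφ n, mul_one])
  · refine squeeze_zero' (.of_forall fun n => norm_nonneg _) ?_ (hlim Kp)
    filter_upwards [eventually_ge_atTop ⌈Np⌉₊] with n hn
    have h := hp' n (Nat.ceil_le.1 hn) (incomingSet k l n m) Set.inter_subset_left (hin n) (φ n)
    exact h.trans_eq (by rw [hφ n, mul_one])
  · exact η.isLocalization_localization hδ _ _
  · rw [← hfar]
    exact η.isLocalization_localization hδ _ _
  · set χ := ContinuousLinearMap.adjoint Ωp φ₀ with hχ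
    have h1 := (hlim Kp).add (tendsto_norm_localization_incoming hm hδ hδm s hs ht χ)
    rw [add_zero] at h1
    refine squeeze_zero' (.of_forall fun n => norm_nonneg _) ?_ h1
    filter_upwards [eventually_ge_atTop ⌈Np⌉₊] with n hn
    have h2 := norm_apply_le_add_norm_apply_adjoint
      (s.localization_adjoint (incomingSet k l n m)) (by positivity)
      (hp' n (Nat.ceil_le.1 hn) (incomingSet k l n m) Set.inter_subset_left (hin n)) (φ n)
    have h3 : ContinuousLinearMap.adjoint Ωp (φ n) = freePropagator (k + l) (t n) χ :=
      (congrArg _ (hφt n)).trans (adjoint_waveOperator_propagator V (Or.inr rfl) hΩp (t n) φ₀)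
    exact h2.trans_eq (congrArg₂ (· + ·) (by rw [hφ n, mul_one]) (congrArg (fun f => ‖s.localization (incomingSet k l n m) f‖) h3))
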